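/- **Zipping Lemma.** Let $X$ be a CAT(0) cube complex, i.e. a simply connected cube complex in which the link of every vertex is a flag complex, with vertex set $V(X)$ and edge set $E(X)$. For $e\in E(X)$ let $W(e)$ be the wall (hyperplane) dual to $e$. Each wall $W$ separates $X$ into two components, whose closures are called half-spaces. Let a group $G$ act on $X$ by cubical automorphisms, let $K\triangleleft G$ act freely on $X$, and let $\mathcal X=X/K$ be the quotient cube complex with its length metric $d$. Write $\overline W$ for the wall of $\mathcal X$ that is the image of a wall $W$ of $X$. Fix $R>1$ and let $\Gamma$ be the graph whose vertices are the walls of $\mathcal X$, two distinct walls $\overline W_1,\overline W_2$ being adjacent if $d(\overline W_1,\overline W_2)\le R$. Fix $k\in\mathbb N$ and let $C_{k+1}(\Gamma)$ be the set of maps $c:V(\Gamma)\to\{1,\dots,k+1\}$ that give different values to adjacent vertices; $G$ acts on it through its action on $\mathcal X$ by $gc=c\circ g^{-1}$. For a wall $W$ of $X$ and $c\in C_{k+1}(\Gamma)$ put $$[c]_W=\{c'\in C_{k+1}(\Gamma): c'=c \text{ on the ball of radius } c(\overline W) \text{ in } \Gamma \text{ centred at } \overline W\},$$ and for $e\in E(X)$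 put $[c]_e=[c]_{W(e)}$ and $c(e)=c(\overline{W(e)})$. Let $j\in\mathbb N$ and let $(Z,H,(c_x))$ be a triple such that $Z\subset X$ is a non-empty intersection of half-spaces, $H\le G$ is a subgroup that preserves $Z$ and acts on it freely and cocompactly, and $c_x\in C_{k+1}(\Gamma)$ for each $x\in V(X)\cap Z$, with $c_{hx}=hc_x$ for $h\in H$, such that 1. if $e\in E(X)$ joins vertices $x,y\in Z$, then $[c_x]_e=[c_y]_e$; 2. if $e\in E(X)$ joins vertices $x,y$ with $x\in Z$, then $y\in Z$ if and only if $c_x(e)>j$. (Every member of the collection $\mathcal V_j$ is such a triple.) Let $c_e\in C_{k+1}(\Gamma)$, for $e\in E(X)$, be colourings such that $[c_e]_e=[c_x]_e$ whenever $e$ is incident at a vertex $x\in Z$. Say that an edge crosses out of $Z$ if exactly one of its endpoints lies in $Z$, and let $W$ be a boundary wall of $Z$, i.e. $W=W(e)$ for some edge $e$ crossing out of $Z$. Then the edges $e$ crossing out of $Z$ with $W(e)=W$ all induce the same class $[c_e]_W$, and hence give the same colour $c_e(\overline W)=c_e(e)$: for any two such edges $e,e'$ one has $[c_e]_W=[c_{e'}]_W$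 and $c_e(\overline W)=c_{e'}(\overline W)$. -/

import Mathlib

open scoped ENNReal

noncomputable section

namespace Cubical

/-! ### Unit cubes and their faces -/

/-- The unit cube `[0,1]^n`. -/
abbrev Cube (n : ℕ) : Type := Fin n → unitInterval

/-- The Euclidean distance on the unit cube. -/
def euclDist {n : ℕ} (s t : Cube n) : ℝ :=
  Real.sqrt (∑ i, ((s i : ℝ) - (t i : ℝ)) ^ 2)

/-- `φ` is an isometry of `[0,1]^m` onto an `m`-dimensional face of `[0,1]^n`: the coordinates
`a j` of `φ t` are the coordinates `t j`, possibly reversed, and the remaining ones are constant,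
equal to `0` or `1`. For `m = n` these are the symmetries of the cube. -/
def IsFaceMap {m n : ℕ} (φ : Cube m → Cube n) : Prop :=
  ∃ (a : Fin m ↪ Fin n) (r : Fin m → Bool) (b : Fin n → Bool), ∀ t : Cube m,
    (∀ j, φ t (a j) = if r j then unitInterval.symm (t j) else t j) ∧
    ∀ i, i ∉ Set.range a → φ t i = if b i then 1 else 0

/-! ### Families of cubes: edges, walls, metric -/

/-- A family of parametrised cubes in a set `Y`. Edges, walls and the length metric make sense for
such a family; this is used for cube complexes and for their quotients. -/
structure CubeFamily (Y : Type*) where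
  /-- the parametrised `n`-cubes -/
  charts : ∀ n : ℕ, Set (Cube n → Y)

namespace CubeFamily

variable {Y Y' : Type*}

/-- The family of images of the cubes under a map. -/
def push (C : CubeFamily Y) (f : Y → Y') : CubeFamily Y' where
  charts n := {τ | ∃ σ ∈ C.charts n, τ = f ∘ σ}

/-- `x` is a vertex. -/
def IsVertex (C : CubeFamily Y) (x : Y) : Prop := ∃ σ ∈ C.charts 0, x ∈ Set.range σ

/-- The vertex set. -/
def Vertex (C : CubeFamily Y) : Type _ := {x : Y // C.IsVertex x}

/-- The set of (unoriented, closed) edges. -/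
def Edge (C : CubeFamily Y) : Type _ := {e : Set Y // ∃ σ ∈ C.charts 1, e = Set.range σ}

/-- The edge of the parametrised cube `σ` at its corner `0` in the direction `i`. -/
def axis {n : ℕ} (σ : Cube n → Y) (i : Fin n) : Set Y := σ '' {t | ∀ l, l ≠ i → t l = 0}

/-- `e` and `f` are opposite edges of a square. -/
def Opposite (C : CubeFamily Y) (e f : C.Edge) : Prop :=
  ∃ σ ∈ C.charts 2, e.1 = σ '' {t | t 1 = 0} ∧ f.1 = σ '' {t | t 1 = 1}

/-- The walls. The wall complex has one vertex (a midpoint) for each edge and one edge (a midcube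
of a square) for each pair of opposite edges of a square, so that its connected components are the
classes of edges under the equivalence relation generated by being opposite in a square. -/
def Wall (C : CubeFamily Y) : Type _ := Quot C.Opposite

/-- The wall `W(e)` to which the edge `e` is dual. -/
def wall (C : CubeFamily Y) (e : C.Edge) : C.Wall := Quot.mk _ e

/-- The wall as a subset: the union of the midcubes whose dual edges are dual to `W`. -/
def Wall.carrier {C : CubeFamily Y} (W : C.Wall) : Set Y :=
  {p | ∃ (n : ℕ) (σ : Cube n → Y) (i : Fin n) (t : Cube n), σ ∈ C.charts n ∧
    (∃ e : C.Edge, C.wall e = W ∧ e.1 = axis σ i) ∧ (t i : ℝ) = 1 / 2 ∧ p = σ t}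

/-- The image of an edge under a map that sends cubes to cubes. -/
def mapEdge {C : CubeFamily Y} {D : CubeFamily Y'} (f : Y → Y')
    (hf : ∀ n, ∀ σ ∈ C.charts n, f ∘ σ ∈ D.charts n) (e : C.Edge) : D.Edge :=
  ⟨f '' e.1, by
    obtain ⟨σ, hσ, he⟩ := e.2
    exact ⟨f ∘ σ, hf 1 σ hσ, by rw [he, Set.range_comp]⟩⟩

/-- The image of a wall under a map that sends cubes to cubes. -/
def mapWall {C : CubeFamily Y} {D : CubeFamily Y'} (f : Y → Y')
    (hf : ∀ n, ∀ σ ∈ C.charts n, f ∘ σ ∈ D.charts n) : C.Wall → D.Wall :=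
  Quot.map (mapEdge f hf) (by
    rintro e e' ⟨σ, hσ, he, he'⟩
    exact ⟨f ∘ σ, hf 2 σ hσ, by simp only [mapEdge, he, Set.image_comp],
      by simp only [mapEdge, he', Set.image_comp]⟩)

/-- `C.HasString p q L`: there is a string `p = p₀, p₁, …, p_m = q` of points, consecutive ones
lying in a common cube, whose total Euclidean length is `L`. -/
inductive HasString (C : CubeFamily Y) : Y → Y → ℝ → Prop
  | nil (p : Y) : HasString C p p 0
  | cons {n : ℕ} {σ : Cube n → Y} (hσ : σ ∈ C.charts n) (s t : Cube n) {q : Y} {L : ℝ}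
      (h : HasString C (σ t) q L) : HasString C (σ s) q (euclDist s t + L)

/-- The intrinsic metric of the complex: the infimum of the lengths of strings (it is `∞` if the
points are not joined by a string). -/
def edist (C : CubeFamily Y) (p q : Y) : ℝ≥0∞ :=
  ⨅ (L : ℝ) (_ : C.HasString p q L), ENNReal.ofReal L

/-- The distance between subsets. -/
def setEDist (C : CubeFamily Y) (A B : Set Y) : ℝ≥0∞ :=
  ⨅ (p ∈ A) (q ∈ B), C.edist p q

/-- The `1`-skeleton, as a graph on the vertices. -/
def skeleton (C : CubeFamily Y) : SimpleGraph C.Vertex where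
  Adj x y := x ≠ y ∧ ∃ e : C.Edge, x.1 ∈ e.1 ∧ y.1 ∈ e.1
  symm := ⟨fun _ _ h => ⟨h.1.symm, h.2.imp fun _ he => ⟨he.2, he.1⟩⟩⟩
  loopless := ⟨fun _ h => h.1 rfl⟩

/-- `a, b, c, d` are the vertices of a square, in cyclic order. -/
def IsSquare (C : CubeFamily Y) (a b c d : C.Vertex) : Prop :=
  ∃ σ ∈ C.charts 2, a.1 = σ ![0, 0] ∧ b.1 = σ ![1, 0] ∧ c.1 = σ ![1, 1] ∧ d.1 = σ ![0, 1]

/-- Homotopy of edge paths with fixed endpoints, generated by adding and removing backtracks and by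
pushing a subpath across a square. -/
inductive EdgeHomotopic (C : CubeFamily Y) :
    ∀ {x y : C.Vertex}, C.skeleton.Walk x y → C.skeleton.Walk x y → Prop
  | refl {x y : C.Vertex} (p : C.skeleton.Walk x y) : EdgeHomotopic C p p
  | symm {x y : C.Vertex} {p q : C.skeleton.Walk x y} :
      EdgeHomotopic C p q → EdgeHomotopic C q p
  | trans {x y : C.Vertex} {p q r : C.skeleton.Walk x y} :
      EdgeHomotopic C p q → EdgeHomotopic C q r → EdgeHomotopic C p r
  | append {x y z : C.Vertex} {p p' : C.skeleton.Walk x y} {q q' : C.skeleton.Walk y z} :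
      EdgeHomotopic C p p' → EdgeHomotopic C q q' → EdgeHomotopic C (p.append q) (p'.append q')
  | backtrack {x y : C.Vertex} (h : C.skeleton.Adj x y) :
      EdgeHomotopic C (.cons h (.cons h.symm .nil)) (.nil : C.skeleton.Walk x x)
  | square {a b c d : C.Vertex} (hs : C.IsSquare a b c d)
      (hab : C.skeleton.Adj a b) (hbc : C.skeleton.Adj b c)
      (had : C.skeleton.Adj a d) (hdc : C.skeleton.Adj d c) :
      EdgeHomotopic C (.cons hab (.cons hbc .nil)) (.cons had (.cons hdc .nil))

/-- Simple connectedness: the complex is connected and every closed edge path is null-homotopic. -/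
def IsSimplyConnected (C : CubeFamily Y) : Prop :=
  C.skeleton.Connected ∧
    ∀ (x : C.Vertex) (p : C.skeleton.Walk x x), C.EdgeHomotopic p .nil

/-- The edges `e 0, …, e (n-1)` form the corner at `x` of an `n`-cube. -/
def IsCorner (C : CubeFamily Y) (x : C.Vertex) {n : ℕ} (e : Fin n → C.Edge) : Prop :=
  ∃ σ ∈ C.charts n, σ (fun _ => 0) = x.1 ∧ ∀ i, (e i).1 = axis σ i

/-- The link of each vertex `x` is a flag complex: distinct edges at `x` that pairwise form corners
of squares at `x` form together the corner of a cube at `x`. -/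
def HasFlagLinks (C : CubeFamily Y) : Prop :=
  ∀ (x : C.Vertex) (n : ℕ) (e : Fin n → C.Edge), Function.Injective e →
    (∀ i, x.1 ∈ (e i).1) → (∀ i l, i ≠ l → C.IsCorner x ![e i, e l]) → C.IsCorner x e

/-- `x` and `y` are joined by an edge path that does not cross the wall `W`. -/
def SameSide (C : CubeFamily Y) (W : C.Wall) (x y : C.Vertex) : Prop :=
  Relation.ReflTransGen
    (fun u v : C.Vertex => ∃ e : C.Edge, u.1 ∈ e.1 ∧ v.1 ∈ e.1 ∧ C.wall e ≠ W) x y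

/-- The (closed) half-space of `W` that contains the vertex `x`: the union of the cubes not
meeting `W` whose vertices lie on the side of `x`, and, for each cube that has a midcube in `W`, of
the closed half of that cube that has its vertices on the side of `x`. In the parametrisation `σ`
the corner `0` is on the side of `x`; the half-cube is given by `t i ≤ 1 / 2`, where `i` is the
direction dual to `W`. -/
def halfSpace (C : CubeFamily Y) (W : C.Wall) (x : C.Vertex) : Set Y :=
  {p | ∃ (n : ℕ) (σ : Cube n → Y) (t : Cube n), σ ∈ C.charts n ∧ p = σ t ∧
    (∃ y : C.Vertex, y.1 = σ (fun _ => 0) ∧ C.SameSide W x y) ∧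
    ∀ i, (∃ e : C.Edge, C.wall e = W ∧ e.1 = axis σ i) → (t i : ℝ) ≤ 1 / 2}

/-- `A` is a half-space. -/
def IsHalfSpace (C : CubeFamily Y) (A : Set Y) : Prop :=
  ∃ (W : C.Wall) (x : C.Vertex), A = C.halfSpace W x

/-- The edge `e` crosses out of `Z`: exactly one of its endpoints lies in `Z`. -/
def CrossesOut (C : CubeFamily Y) (Z : Set Y) (e : C.Edge) : Prop :=
  ∃ x y : C.Vertex, x.1 ∈ e.1 ∧ y.1 ∈ e.1 ∧ x.1 ∈ Z ∧ y.1 ∉ Z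

/-- `W` is a boundary wall of `Z`. -/
def IsBoundaryWall (C : CubeFamily Y) (Z : Set Y) (W : C.Wall) : Prop :=
  ∃ e : C.Edge, C.CrossesOut Z e ∧ C.wall e = W

end CubeFamily

/-! ### Cube complexes -/

/-- A cube complex with underlying set `X`: it is covered by embedded unit cubes, any two of which
are disjoint or meet in a common face, along which their parametrisations differ by an isometry.
All parametrisations of all faces of the cubes are among the `charts`. -/
structure CubeComplex (X : Type*) extends CubeFamily X where
  injective : ∀ n, ∀ σ ∈ charts n, Function.Injective σ
  cover : ∀ p : X, ∃ n, ∃ σ ∈ charts n, p ∈ Set.range σ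
  face : ∀ (m n : ℕ) (φ : Cube m → Cube n), IsFaceMap φ → ∀ σ ∈ charts n, σ ∘ φ ∈ charts m
  inter : ∀ (m n : ℕ), ∀ σ ∈ charts m, ∀ τ ∈ charts n, (Set.range σ ∩ Set.range τ).Nonempty →
    ∃ (k : ℕ) (φ : Cube k → Cube m) (ψ : Cube k → Cube n), IsFaceMap φ ∧ IsFaceMap ψ ∧
      σ ∘ φ = τ ∘ ψ ∧ Set.range σ ∩ Set.range τ = Set.range (σ ∘ φ)

namespace CubeComplex

variable {X : Type*} (C : CubeComplex X)

/-- A CAT(0) cube complex: simply connected, with flag links. -/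
def IsCAT0 : Prop := C.HasFlagLinks ∧ C.IsSimplyConnected

variable {G : Type*} [Group G] [MulAction G X]

/-- `G` acts on the cube complex by automorphisms. -/
def ActsCubically (G : Type*) [Group G] [MulAction G X] : Prop :=
  ∀ (g : G) (n : ℕ), ∀ σ ∈ C.charts n, (fun p : X => g • p) ∘ σ ∈ C.charts n

variable {C} in
/-- The translate `g W` of a wall of `X`. -/
def ActsCubically.smulWall (hG : C.ActsCubically G) (g : G) : C.Wall → C.Wall :=
  CubeFamily.mapWall (fun p : X => g • p) (hG g)

/-! ### The quotient complex and colourings of its walls -/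

/-- The quotient complex `𝒳 = X / K`, with its cubes the images of the cubes of `X`. -/
def quotient (K : Subgroup G) : CubeFamily (MulAction.orbitRel.Quotient K X) :=
  C.toCubeFamily.push (fun p => (Quotient.mk _ p : MulAction.orbitRel.Quotient K X))

/-- The image in `𝒳` of a wall of `X`. -/
def bar (K : Subgroup G) : C.Wall → (C.quotient K).Wall :=
  CubeFamily.mapWall _ (fun _ σ hσ => ⟨σ, hσ, rfl⟩)

/-- The graph `Γ`: its vertices are the walls of `𝒳`, and two (distinct) walls are joined by an
edge if their distance in `𝒳` is at most `R`. -/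
def wallGraph (K : Subgroup G) (R : ℝ) : SimpleGraph (C.quotient K).Wall :=
  SimpleGraph.fromRel fun V V' =>
    (C.quotient K).setEDist V.carrier V'.carrier ≤ ENNReal.ofReal R

/-- The set `C_{k+1}(Γ)` of proper colourings of `Γ` with colours `1, …, k+1`. -/
abbrev Colouring (K : Subgroup G) (R : ℝ) (k : ℕ) : Type _ :=
  (C.wallGraph K R).Coloring (Set.Icc 1 (k + 1))

variable {C} {K : Subgroup G} {R : ℝ} {k : ℕ}

/-- The colour, a natural number, that `c` gives to the image in `𝒳` of the wall `W` of `X`. -/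
def Colouring.colour (c : C.Colouring K R k) (W : C.Wall) : ℕ := (c (C.bar K W) : ℕ)

/-- The class `[c]_W`: the colourings that agree with `c` on the ball in `Γ` whose centre is the
image of `W` and whose radius is the colour of `W` under `c`. -/
def Colouring.cls (c : C.Colouring K R k) (W : C.Wall) : Set (C.Colouring K R k) :=
  {c' | ∀ V, (C.wallGraph K R).edist (C.bar K W) V ≤ (c.colour W : ℕ∞) → c' V = c V}

/-! ### Triples -/

/-- The triples `(Z, H, (c_x))` of level `j`. -/
structure Triple (hG : C.ActsCubically G) (K : Subgroup G) (R : ℝ) (k j : ℕ) where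
  Z : Set X
  H : Subgroup G
  /-- the colourings `c_x`, for the vertices `x` in `Z` -/
  c : ∀ x : C.Vertex, x.1 ∈ Z → C.Colouring K R k
  nonempty : Z.Nonempty
  /-- `Z` is an intersection of half-spaces (of no half-space if `Z = X`) -/
  inter_halfSpaces : ∃ 𝓕 : Set (Set X), (∀ A ∈ 𝓕, C.IsHalfSpace A) ∧ Z = ⋂₀ 𝓕
  /-- `H` acts on `Z` -/
  smul_mem : ∀ h ∈ H, ∀ p ∈ Z, h • p ∈ Z
  /-- the action on `Z` is free -/
  free : ∀ h ∈ H, ∀ p ∈ Z, h • p = p → h = 1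
  /-- the action on `Z` is cocompact: the translates of finitely many cubes cover `Z` -/
  cocompact : ∃ 𝓠 : Set (Set X), 𝓠.Finite ∧
    (∀ Q ∈ 𝓠, ∃ n, ∃ σ ∈ C.charts n, Q = Set.range σ) ∧
    ∀ p ∈ Z, ∃ h ∈ H, ∃ Q ∈ 𝓠, h • p ∈ Q
  /-- `c_{hx} = h c_x`, where `h c_x` gives to the image of `hW` the colour that `c_x` gives to the
  image of `W` -/
  equivariant : ∀ h ∈ H, ∀ (x y : C.Vertex) (hx : x.1 ∈ Z) (hy : y.1 ∈ Z), y.1 = h • x.1 →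
    ∀ W : C.Wall, (c y hy).colour (hG.smulWall h W) = (c x hx).colour W
  /-- adjacent vertices of `Z` have similar colourings: `[c_x]_e = [c_y]_e` -/
  adjacent : ∀ (e : C.Edge) (x y : C.Vertex) (hx : x.1 ∈ Z) (hy : y.1 ∈ Z), x ≠ y →
    x.1 ∈ e.1 → y.1 ∈ e.1 → (c x hx).cls (C.wall e) = (c y hy).cls (C.wall e)
  /-- for an edge `e` joining `x ∈ Z` to `y`: `y ∈ Z` if and only if `c_x(e) > j` -/
  boundary : ∀ (e : C.Edge) (x y : C.Vertex) (hx : x.1 ∈ Z), x ≠ y →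
    x.1 ∈ e.1 → y.1 ∈ e.1 → (y.1 ∈ Z ↔ j < (c x hx).colour (C.wall e))

/-- The colourings `cE e` are admissible colourings `c_e` for the edges: if `e` is incident at a
vertex `x ∈ Z`, then `[c_e]_e = [c_x]_e`. -/
def Triple.IsEdgeColouring {hG : C.ActsCubically G} {j : ℕ} (T : Triple hG K R k j)
    (cE : C.Edge → C.Colouring K R k) : Prop :=
  ∀ (e : C.Edge) (x : C.Vertex) (hx : x.1 ∈ T.Z), x.1 ∈ e.1 →
    (cE e).cls (C.wall e) = (T.c x hx).cls (C.wall e)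

end CubeComplex

end Cubical

end

/-! Let `xz` and `x'z'` be edges dual to `W` that cross out of `Z` at `x` and `x'`. Push `xz` across
squares along a geodesic from `x` to `x'`, which stays in `Z` by convexity (`mem_sInter_of_closer`).
At a step from `x` to `x₁`, condition 2 gives `xz` a colour at most `j` and `xx₁` a colour greater
than `j`. The walls of these edges cross, and their images have different colours, so these images
are adjacent in `Γ`. Hence the ball that defines the class of `W` lies in the ball that defines the
class of `xx₁`, where `c_x` and `c_{x₁}` agree by condition 1. So the class of `W` does not change,
and the pushed edge still leaves `Z` (`Triple.cls_eq_of_isSquare`, iterated in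
`Triple.cls_eq_of_separated`).

The squares come from the quadrangle condition for the graph distance of the `1`-skeleton
(`quadrangle`); it also shows that the edges dual to one wall separate the vertices in the same way,
so that half-spaces can be described by distances (`mem_closer_of_sameSide`,
`separated_of_sameSide`).

The quadrangle condition is proved by studying paths modulo flips across squares. Equivalent paths
are compared at their last edges (`FlipEqv.lastEdges`); this is where flag links enter, by
completing three squares at a vertex to a cube. Classes of reduced paths from a base point behave
like a covering of the complex: `FlipClass.extend` lifts edges, compatibly with backtracks and
squares. Simple connectedness makes the monodromy trivial, so each vertex carries one class. Reduced
paths are then geodesics, and comparing the last edges of two geodesics gives the required square.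
-/

namespace Cubical

/-! ### Graphs with squares -/

/-- The combinatorial properties of the squares of a cube complex with flag links. -/
structure SquareAxioms {V : Type*} (G : SimpleGraph V) (Sq : V → V → V → V → Prop) : Prop where
  adj : ∀ {a b c d}, Sq a b c d → G.Adj a b
  rot : ∀ {a b c d}, Sq a b c d → Sq b c d a
  flip : ∀ {a b c d}, Sq a b c d → Sq a d c b
  ne : ∀ {a b c d}, Sq a b c d → a ≠ c
  unique : ∀ {a b c c' d}, Sq a b c d → Sq a b c' d → c = c'
  cube : ∀ {y a b f p q r}, Sq y a p b → Sq y a q f → Sq y b r f →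
    ∃ d, Sq a p d q ∧ Sq b p d r ∧ Sq f q d r

/-! ### Paths modulo flips, and their last edges -/

/-- Equivalence of paths (as lists of vertices, the last vertex of the path coming first)
generated by pushing subpaths of length `2` across squares. -/
inductive FlipEqv {V : Type*} (Sq : V → V → V → V → Prop) : List V → List V → Prop
  | refl (l) : FlipEqv Sq l l
  | symm {l l'} : FlipEqv Sq l l' → FlipEqv Sq l' l
  | trans {l l' l''} : FlipEqv Sq l l' → FlipEqv Sq l' l'' → FlipEqv Sq l l''
  | cons (u) {l l'} : FlipEqv Sq l l' → FlipEqv Sq (u :: l) (u :: l')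
  | flip {a b c d} (l) : Sq a b c d → FlipEqv Sq (c :: b :: a :: l) (c :: d :: a :: l)

section Flip

variable {V : Type*} {G : SimpleGraph V} {Sq : V → V → V → V → Prop}

theorem FlipEqv.length_eq {l l' : List V} (h : FlipEqv Sq l l') : l.length = l'.length := by
  induction h with
  | refl => rfl
  | symm _ ih => exact ih.symm
  | trans _ _ ih ih' => exact ih.trans ih'
  | cons _ _ ih => simp [ih]
  | flip => simp

/-- The possible relations between two equivalent paths, in terms of their last edges: they are
equal up to equivalence of their initial parts, or the last edges span a square. -/
def LastEdges (Sq : V → V → V → V → Prop) (l l' : List V) : Prop :=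
  l = l' ∨ ∃ v y p y' q, l = v :: y :: p ∧ l' = v :: y' :: q ∧
    ((y = y' ∧ FlipEqv Sq (y :: p) (y' :: q)) ∨
      ∃ w r, Sq w y v y' ∧ FlipEqv Sq (y :: p) (y :: w :: r) ∧ FlipEqv Sq (y' :: q) (y' :: w :: r))

theorem LastEdges.symm (hS : SquareAxioms G Sq) {l l' : List V} (h : LastEdges Sq l l') :
    LastEdges Sq l' l := by
  rcases h with h | ⟨v, y, p, y', q, h1, h2, h⟩
  · exact Or.inl h.symm
  · refine Or.inr ⟨v, y', q, y, p, h2, h1, ?_⟩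
    rcases h with ⟨h, h'⟩ | ⟨w, r, hs, h, h'⟩
    · exact Or.inl ⟨h.symm, h'.symm⟩
    · exact Or.inr ⟨w, r, hS.flip hs, h', h⟩

/-- In the main case two squares at `v` share the edge `y'v`. Comparing the two decompositions of
the shorter path to `y'` shows either that the squares coincide or that a third square at `y'` is
present. In the latter case the three squares span a cube, and its square containing `y`, `v`, `y''`
is the one needed. -/
theorem LastEdges.trans (hS : SquareAxioms G Sq) {l l' l'' : List V}
    (ih : ∀ m m' : List V, m.length < l'.length → FlipEqv Sq m m' → LastEdges Sq m m')
    (h : LastEdges Sq l l') (h' : LastEdges Sq l' l'') : LastEdges Sq l l'' := by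
  rcases h with rfl | ⟨v, y, p, y', q, rfl, rfl, h⟩
  · exact h'
  rcases h' with rfl | ⟨v', y₁, q', y'', s, e1, rfl, h'⟩
  · exact Or.inr ⟨v, y, p, y', q, rfl, rfl, h⟩
  simp only [List.cons.injEq] at e1
  obtain ⟨rfl, rfl, rfl⟩ := e1
  refine Or.inr ⟨v, y, p, y'', s, rfl, rfl, ?_⟩
  rcases h with ⟨rfl, h⟩ | ⟨w, r, hs, h1, h2⟩
  · rcases h' with ⟨rfl, h'⟩ | ⟨w, r, hs, h1, h2⟩
    · exact Or.inl ⟨rfl, h.trans h'⟩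
    · exact Or.inr ⟨w, r, hs, h.trans h1, h2⟩
  rcases h' with ⟨rfl, h'⟩ | ⟨w', r', hs', h1', h2'⟩
  · exact Or.inr ⟨w, r, hs, h1, h'.symm.trans h2⟩
  have hmid := h2.symm.trans h1'
  have hlen := h2.length_eq
  have hcase : (w = w' ∧ FlipEqv Sq (w :: r) (w' :: r')) ∨ ∃ t s, Sq t w y' w' ∧
      FlipEqv Sq (w :: r) (w :: t :: s) ∧ FlipEqv Sq (w' :: r') (w' :: t :: s) := by
    rcases ih _ _ (by simp at hlen ⊢; omega) hmid with h | ⟨_, _, _, _, _, e1, e2, h⟩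
    · simp only [List.cons.injEq, true_and] at h
      obtain ⟨rfl, rfl⟩ := h
      exact Or.inl ⟨rfl, .refl _⟩
    · simp only [List.cons.injEq] at e1 e2
      obtain ⟨rfl, rfl, rfl⟩ := e1
      obtain ⟨-, rfl, rfl⟩ := e2
      exact h
  rcases hcase with ⟨rfl, h⟩ | ⟨t, u, ht, h, h'⟩
  · have : y = y'' := hS.unique (hS.rot (hS.rot (hS.rot hs)))
      (hS.flip (hS.rot hs'))
    subst this
    exact Or.inl ⟨rfl, h1.trans (.trans (.cons _ h) h2'.symm)⟩
  -- The cube is based at `y'`, with neighbours `w'`, `w`, `v`; `d` is the vertex opposite to `y'`.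
  · obtain ⟨d, hd1, hd2, hd3⟩ := hS.cube (hS.rot (hS.rot ht)) (hS.flip (hS.rot hs'))
      (hS.rot (hS.rot (hS.rot hs)))
    refine Or.inr ⟨d, t :: u, hS.rot (hS.rot hd3), ?_, ?_⟩
    · exact h1.trans (.trans (.cons _ h) (.flip _ (hS.rot (hS.rot (hS.rot (hS.flip hd2))))))
    · exact h2'.trans (.trans (.cons _ h') (.flip _ (hS.rot (hS.rot (hS.rot (hS.flip hd1))))))

/-- The induction on the derivation runs inside a strong induction on length, because transitivity
needs the result for shorter paths that do not occur in the derivation. -/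
theorem FlipEqv.lastEdges (hS : SquareAxioms G Sq) {l l' : List V} (h : FlipEqv Sq l l') :
    LastEdges Sq l l' := by
  induction hn : l.length using Nat.strong_induction_on generalizing l l' with
  | _ n IH =>
    induction h with
    | refl => exact Or.inl rfl
    | symm h ih => exact (ih (h.length_eq.trans hn)).symm hS
    | trans h h' ih ih' =>
      have e := h.length_eq.symm.trans hn
      exact (ih hn).trans hS (fun m m' hm hmm => IH _ (e ▸ hm) hmm rfl) (ih' e)
    | cons u h ih =>
      rcases IH _ (by simp at hn; omega) h rfl with rfl | ⟨v, y, p, y', q, rfl, rfl, -⟩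
      · exact Or.inl rfl
      · exact Or.inr ⟨u, v, _, v, _, rfl, rfl, Or.inl ⟨rfl, h⟩⟩
    | flip l hs => exact Or.inr ⟨_, _, _, _, _, rfl, rfl, Or.inr ⟨_, _, hs, .refl _, .refl _⟩⟩

theorem FlipEqv.last_edges (hS : SquareAxioms G Sq) {v v' y y' : V} {p q : List V}
    (h : FlipEqv Sq (v :: y :: p) (v' :: y' :: q)) :
    (y = y' ∧ FlipEqv Sq (y :: p) (y' :: q)) ∨
      ∃ w r, Sq w y v y' ∧ FlipEqv Sq (y :: p) (y :: w :: r) ∧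
        FlipEqv Sq (y' :: q) (y' :: w :: r) := by
  rcases h.lastEdges hS with h | ⟨_, _, _, _, _, e1, e2, h⟩
  · simp only [List.cons.injEq] at h
    obtain ⟨-, rfl, rfl⟩ := h
    exact Or.inl ⟨rfl, .refl _⟩
  · simp only [List.cons.injEq] at e1 e2
    obtain ⟨rfl, rfl, rfl⟩ := e1
    obtain ⟨-, rfl, rfl⟩ := e2
    exact h

theorem FlipEqv.head_eq (hS : SquareAxioms G Sq) {v v' : V} {p q : List V}
    (h : FlipEqv Sq (v :: p) (v' :: q)) : v = v' := by
  rcases h.lastEdges hS with h | ⟨_, _, _, _, _, e1, e2, h⟩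
  · exact (List.cons.inj h).1
  · exact (List.cons.inj e1).1.trans (List.cons.inj e2).1.symm

/-- A square with last edges `yv` and `yv` would have `y` opposite to itself, so only the first
alternative for the last edges remains. -/
theorem FlipEqv.cancel (hS : SquareAxioms G Sq) {v v' y : V} {p q : List V}
    (h : FlipEqv Sq (v :: y :: p) (v' :: y :: q)) : FlipEqv Sq (y :: p) (y :: q) := by
  rcases h.last_edges hS with h | ⟨w, r, hs, -, -⟩
  · exact h.2
  · exact absurd rfl (hS.ne (hS.rot hs))

/-! ### Descents and reduced paths -/

/-- Up to equivalence, the path `l` arrives at its end from the vertex `u`. -/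
def Descent (Sq : V → V → V → V → Prop) (l : List V) (u : V) : Prop :=
  ∃ v r, FlipEqv Sq l (v :: u :: r)

theorem Descent.congr {l l' : List V} {u : V} (h : FlipEqv Sq l l') (hd : Descent Sq l u) :
    Descent Sq l' u := by
  obtain ⟨v, r, hr⟩ := hd
  exact ⟨v, r, h.symm.trans hr⟩

/-- If `a, b, c, d` is a square and a path ending with the edge `ab` may also arrive from `c`, then
its initial part may arrive from `d`. -/
theorem Descent.of_square (hS : SquareAxioms G Sq) {a b c d : V} {l : List V} (hs : Sq a b c d)
    (h : Descent Sq (b :: a :: l) c) : Descent Sq (a :: l) d := by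
  obtain ⟨v, r, h⟩ := h
  rcases h.last_edges hS with ⟨h, -⟩ | ⟨w, r', hw, h, -⟩
  · exact absurd h (hS.ne hs)
  · have : w = d := hS.unique (hS.rot (hS.rot hw)) (hS.rot hs)
    subst this
    exact ⟨_, _, h⟩

/-- If `a, b, c, d` is a square and a path to `a` may arrive from `d`, then, extended by the edge
`ab`, it may arrive from `c`. -/
theorem Descent.to_square (hS : SquareAxioms G Sq) {a b c d : V} {l : List V} (hs : Sq a b c d)
    (h : Descent Sq (a :: l) d) : Descent Sq (b :: a :: l) c := by
  obtain ⟨v, r, h⟩ := h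
  obtain rfl := h.head_eq hS
  exact ⟨b, d :: r, (h.cons b).trans (.flip _ (hS.rot (hS.rot (hS.rot hs))))⟩

/-- Reduced paths starting at `o`: paths that are not equivalent to a path with a backtrack. -/
def Reduced (G : SimpleGraph V) (Sq : V → V → V → V → Prop) (o : V) : List V → Prop
  | [] => False
  | [x] => x = o
  | u :: v :: l => G.Adj v u ∧ ¬ Descent Sq (v :: l) u ∧ Reduced G Sq o (v :: l)

/-- A flip exchanges the two conditions on its edges: a descent on one side of the square is carried
to the opposite edge by `Descent.of_square` or `Descent.to_square`. -/
theorem Reduced.congr (hS : SquareAxioms G Sq) {o : V} {l l' : List V} (h : FlipEqv Sq l l') :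
    Reduced G Sq o l ↔ Reduced G Sq o l' := by
  induction h with
  | refl => rfl
  | symm _ ih => exact ih.symm
  | trans _ _ ih ih' => exact ih.trans ih'
  | @cons u l l' h ih =>
    rcases h.lastEdges hS with rfl | ⟨v, y, p, y', q, rfl, rfl, -⟩
    · rfl
    · exact and_congr Iff.rfl (and_congr (not_congr ⟨.congr h, .congr h.symm⟩) ih)
  | @flip a b c d l hs =>
    have key : ∀ {b d}, Sq a b c d → Reduced G Sq o (c :: b :: a :: l) →
        Reduced G Sq o (c :: d :: a :: l) := fun {b d} hs h =>
      ⟨(hS.adj (hS.rot (hS.rot hs))).symm, fun hd => h.2.2.2.1 (hd.of_square hS (hS.flip hs)),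
        hS.adj (hS.flip hs), fun hd => h.2.1 (hd.to_square hS hs), h.2.2.2.2⟩
    exact ⟨key hs, key (hS.flip hs)⟩

theorem Reduced.exists_walk {o v : V} {l : List V} (h : Reduced G Sq o (v :: l)) :
    ∃ p : G.Walk o v, p.length = l.length := by
  induction l generalizing v with
  | nil => obtain rfl : v = o := h; exact ⟨.nil, rfl⟩
  | cons u l ih =>
    obtain ⟨p, hp⟩ := ih h.2.2
    exact ⟨p.concat h.1, by simp [hp]⟩

/-! ### Lifting walks to classes of reduced paths -/

variable (Sq) in
/-- Paths up to equivalence. -/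
def flipSetoid : Setoid (List V) where
  r := FlipEqv Sq
  iseqv := ⟨.refl, .symm, .trans⟩

variable (Sq) in
/-- Classes of paths up to equivalence. -/
abbrev FlipClass : Type _ := Quotient (flipSetoid Sq)

variable (Sq) in
/-- The class of a path. -/
def flipClass (l : List V) : FlipClass Sq := Quotient.mk (flipSetoid Sq) l

theorem flipClass_eq {l l' : List V} : flipClass Sq l = flipClass Sq l' ↔ FlipEqv Sq l l' :=
  Quotient.eq (r := flipSetoid Sq)

open Classical in
/-- Extends a class of paths by an edge to `u`, with cancellation if a backtrack arises. -/
noncomputable def FlipClass.extend (A : FlipClass Sq) (u : V) : FlipClass Sq :=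
  if h : ∃ v r, A = flipClass Sq (v :: u :: r) then flipClass Sq (u :: h.choose_spec.choose)
  else A.liftOn (fun l => flipClass Sq (u :: l)) fun _ _ h => flipClass_eq.2 (.cons u h)

/-- By `FlipEqv.cancel` the representative chosen in `FlipClass.extend` does not matter. -/
theorem extend_cancel (hS : SquareAxioms G Sq) (v u : V) (r : List V) :
    (flipClass Sq (v :: u :: r)).extend u = flipClass Sq (u :: r) := by
  have h : ∃ v' r', flipClass Sq (v :: u :: r) = flipClass Sq (v' :: u :: r') := ⟨v, r, rfl⟩
  rw [FlipClass.extend, dif_pos h]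
  exact flipClass_eq.2 ((flipClass_eq.1 h.choose_spec.choose_spec).cancel hS).symm

theorem extend_cons {l : List V} {u : V} (h : ¬ Descent Sq l u) :
    (flipClass Sq l).extend u = flipClass Sq (u :: l) := by
  have h : ¬ ∃ v' r', flipClass Sq l = flipClass Sq (v' :: u :: r') := by
    simp only [flipClass_eq]
    exact h
  rw [FlipClass.extend, dif_neg h]
  rfl

/-- Either the extension of a reduced path is a reduced path, or there is a cancellation. -/
theorem Reduced.extend_cases (hS : SquareAxioms G Sq) {o v u : V} {l : List V}
    (h : Reduced G Sq o (v :: l)) (huv : G.Adj v u) :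
    (¬ Descent Sq (v :: l) u ∧ Reduced G Sq o (u :: v :: l) ∧
      (flipClass Sq (v :: l)).extend u = flipClass Sq (u :: v :: l)) ∨
    ∃ r, flipClass Sq (v :: l) = flipClass Sq (v :: u :: r) ∧ Reduced G Sq o (v :: u :: r) ∧
      (flipClass Sq (v :: l)).extend u = flipClass Sq (u :: r) := by
  by_cases hd : Descent Sq (v :: l) u
  · obtain ⟨v', r, hr⟩ := hd
    obtain rfl := hr.head_eq hS
    have e := flipClass_eq.2 hr
    exact Or.inr ⟨r, e, (Reduced.congr hS hr).1 h, e ▸ extend_cancel hS _ _ _⟩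
  · exact Or.inl ⟨hd, ⟨huv, hd, h⟩, extend_cons hd⟩

/-- A class of reduced paths from `o` to `v`. -/
def IsReducedClass (G : SimpleGraph V) (o v : V) (A : FlipClass Sq) : Prop :=
  ∃ l, A = flipClass Sq (v :: l) ∧ Reduced G Sq o (v :: l)

theorem IsReducedClass.extend (hS : SquareAxioms G Sq) {o v u : V} {A : FlipClass Sq}
    (h : IsReducedClass G o v A) (huv : G.Adj v u) : IsReducedClass G o u (A.extend u) := by
  obtain ⟨l, rfl, h⟩ := h
  rcases h.extend_cases hS huv with ⟨-, h, e⟩ | ⟨r, -, h, e⟩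
  · exact ⟨_, e, h⟩
  · exact ⟨_, e, h.2.2⟩

/-- Lifts respect backtracks. If the first extension cancels, reducedness ensures that the second
one appends `v` again. -/
theorem IsReducedClass.extend_extend (hS : SquareAxioms G Sq) {o v u : V} {A : FlipClass Sq}
    (h : IsReducedClass G o v A) (huv : G.Adj v u) : (A.extend u).extend v = A := by
  obtain ⟨l, rfl, h⟩ := h
  rcases h.extend_cases hS huv with ⟨-, h, e⟩ | ⟨r, e', h, e⟩
  · rw [e, extend_cancel hS]
  · rw [e, e', extend_cons h.2.1]

/-- Lifts respect squares; the cases are whether the path may arrive at `a` from `b` and from `d`.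
If from both, both routes cancel twice and meet in the same path to `c`; if from neither, both
append two edges and differ by a flip. If from one only, one route cancels and then appends, while
the other appends and, after a flip, cancels. -/
theorem IsReducedClass.extend_square (hS : SquareAxioms G Sq) {o a b c d : V} {A : FlipClass Sq}
    (h : IsReducedClass G o a A) (hs : Sq a b c d) :
    (A.extend b).extend c = (A.extend d).extend c := by
  have mixed : ∀ {b d : V} {l r : List V}, Sq a b c d → ¬ Descent Sq (a :: l) d →
      FlipEqv Sq (a :: l) (a :: b :: r) →
      ((flipClass Sq (a :: l)).extend b).extend c = ((flipClass Sq (a :: l)).extend d).extend c := by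
    intro b d l r hs hd e
    rw [extend_cons hd, flipClass_eq.2 e, extend_cancel hS, extend_cons,
      flipClass_eq.2 ((e.cons d).trans (FlipEqv.flip r (hS.rot hs)).symm), extend_cancel hS]
    exact fun hc => hd ((hc.to_square hS (hS.flip (hS.rot hs))).congr e.symm)
  obtain ⟨l, rfl, h⟩ := h
  by_cases hb : Descent Sq (a :: l) b <;> by_cases hd : Descent Sq (a :: l) d
  · obtain ⟨v, r, hb⟩ := hb
    obtain ⟨v', r', hd⟩ := hd
    obtain rfl := hb.head_eq hS
    obtain rfl := hd.head_eq hS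
    rcases (hb.symm.trans hd).last_edges hS with ⟨h, -⟩ | ⟨w, s, hw, h1, h2⟩
    · exact absurd h (hS.ne (hS.rot hs))
    · obtain rfl : w = c := hS.unique (hS.rot (hS.rot hw)) (hS.flip hs)
      rw [flipClass_eq.2 hb, extend_cancel hS, flipClass_eq.2 h1, extend_cancel hS,
        ← flipClass_eq.2 hb, flipClass_eq.2 hd, extend_cancel hS, flipClass_eq.2 h2,
        extend_cancel hS]
  · obtain ⟨v, r, hb⟩ := hb
    obtain rfl := hb.head_eq hS
    exact mixed hs hd hb
  · obtain ⟨v, r, hd⟩ := hd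
    obtain rfl := hd.head_eq hS
    exact (mixed (hS.flip hs) hb hd).symm
  · rw [extend_cons hb, extend_cons hd, extend_cons fun hc => hd (hc.of_square hS hs),
      extend_cons fun hc => hb (hc.of_square hS (hS.flip hs))]
    exact flipClass_eq.2 (.flip _ hs)

/-- Extends a class of paths along a walk. -/
noncomputable def FlipClass.extendWalk : ∀ {x y : V}, G.Walk x y → FlipClass Sq → FlipClass Sq
  | _, _, .nil, A => A
  | _, _, .cons (v := u) _ p, A => extendWalk p (A.extend u)

theorem extendWalk_append {x y z : V} (p : G.Walk x y) (q : G.Walk y z) (A : FlipClass Sq) :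
    A.extendWalk (p.append q) = (A.extendWalk p).extendWalk q := by
  induction p generalizing A with
  | nil => rfl
  | cons h p ih => exact ih q _

theorem IsReducedClass.extendWalk (hS : SquareAxioms G Sq) {o x y : V} (p : G.Walk x y)
    {A : FlipClass Sq} (h : IsReducedClass G o x A) : IsReducedClass G o y (A.extendWalk p) := by
  induction p generalizing A with
  | nil => exact h
  | cons hu p ih => exact ih (h.extend hS hu)

/-- The class of the trivial path. -/
theorem isReducedClass_nil (o : V) : IsReducedClass G o o (flipClass Sq [o]) := ⟨[], rfl, rfl⟩

theorem Reduced.exists_extendWalk {o v : V} {l : List V} (h : Reduced G Sq o (v :: l)) :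
    ∃ p : G.Walk o v, (flipClass Sq [o]).extendWalk p = flipClass Sq (v :: l) := by
  induction l generalizing v with
  | nil => obtain rfl : v = o := h; exact ⟨.nil, rfl⟩
  | cons u l ih =>
    obtain ⟨p, hp⟩ := ih h.2.2
    refine ⟨p.append (.cons h.1 .nil), ?_⟩
    rw [extendWalk_append, hp]
    exact extend_cons h.2.1

/-- Each edge of the walk lengthens or shortens the path by one. The lists `l` and `l'` omit the
endpoint, so their lengths are the numbers of edges. -/
theorem length_extendWalk_le (hS : SquareAxioms G Sq) {o x y : V} (p : G.Walk x y)
    {l l' : List V} (h : Reduced G Sq o (x :: l))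
    (h' : (flipClass Sq (x :: l)).extendWalk p = flipClass Sq (y :: l')) :
    l'.length ≤ l.length + p.length := by
  induction p generalizing l with
  | nil => simpa using (flipClass_eq.1 h').length_eq.ge
  | cons hu p ih =>
    rw [FlipClass.extendWalk] at h'
    rcases h.extend_cases hS hu with ⟨-, h, e⟩ | ⟨r, e', h, e⟩
    · rw [e] at h'
      have := ih h h'
      simp at this ⊢; omega
    · rw [e] at h'
      have := ih h.2.2 h'
      have := (flipClass_eq.1 e').length_eq
      simp at this ⊢; omega

/-! ### Trivial monodromy and the graph distance -/

/-- The extension of classes of reduced paths along a walk depends only on its endpoints. -/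
def TrivialMonodromy (G : SimpleGraph V) (Sq : V → V → V → V → Prop) : Prop :=
  ∀ (o v : V) (p q : G.Walk o v),
    (flipClass Sq [o]).extendWalk p = (flipClass Sq [o]).extendWalk q

theorem Reduced.flipEqv (hM : TrivialMonodromy G Sq) {o v : V} {l l' : List V}
    (h : Reduced G Sq o (v :: l)) (h' : Reduced G Sq o (v :: l')) :
    FlipEqv Sq (v :: l) (v :: l') := by
  obtain ⟨p, hp⟩ := h.exists_extendWalk
  obtain ⟨q, hq⟩ := h'.exists_extendWalk
  rw [← flipClass_eq, ← hp, ← hq, hM]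

theorem exists_reduced (hS : SquareAxioms G Sq) (hG : G.Connected) (o v : V) :
    ∃ l, Reduced G Sq o (v :: l) := by
  obtain ⟨p⟩ := hG.preconnected o v
  obtain ⟨l, -, h⟩ := (isReducedClass_nil o).extendWalk hS (Sq := Sq) p
  exact ⟨l, h⟩

/-- The lift of a shortest walk to `v` is the class of the given reduced path, and a lift is never
longer than its walk. -/
theorem Reduced.dist_eq (hS : SquareAxioms G Sq) (hG : G.Connected) (hM : TrivialMonodromy G Sq)
    {o v : V} {l : List V} (h : Reduced G Sq o (v :: l)) : G.dist o v = l.length := by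
  apply le_antisymm
  · obtain ⟨p, hp⟩ := h.exists_walk
    exact hp ▸ SimpleGraph.dist_le p
  · obtain ⟨p, hp⟩ := hG.exists_walk_length_eq_dist o v
    obtain ⟨q, hq⟩ := h.exists_extendWalk
    have := length_extendWalk_le hS p (l := []) (o := o) (by rfl) ((hM _ _ p q).trans hq)
    simpa [hp] using this

theorem dist_adj (hS : SquareAxioms G Sq) (hG : G.Connected) (hM : TrivialMonodromy G Sq)
    (o : V) {v u : V} (huv : G.Adj v u) :
    G.dist o u = G.dist o v + 1 ∨ G.dist o v = G.dist o u + 1 := by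
  obtain ⟨l, h⟩ := exists_reduced hS hG o v
  rcases h.extend_cases hS huv with ⟨-, h', -⟩ | ⟨r, -, h', -⟩
  · left; simp [h.dist_eq hS hG hM, h'.dist_eq hS hG hM]
  · right; simp [h'.2.2.dist_eq hS hG hM, h'.dist_eq hS hG hM]

/-- The quadrangle condition. -/
theorem quadrangle (hS : SquareAxioms G Sq) (hG : G.Connected) (hM : TrivialMonodromy G Sq)
    {o x y z : V} (hx : G.Adj x z) (hy : G.Adj y z) (hxy : x ≠ y)
    (hdx : G.dist o z = G.dist o x + 1) (hdy : G.dist o z = G.dist o y + 1) :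
    ∃ w, Sq w x z y ∧ G.dist o x = G.dist o w + 1 := by
  -- A reduced path to `x` extends to `z` without cancellation, since a cancellation would make `z`
  -- nearer to `o` than `x`.
  have key : ∀ {x}, G.Adj x z → G.dist o z = G.dist o x + 1 →
      ∃ l, Reduced G Sq o (z :: x :: l) := by
    intro x hx hd
    obtain ⟨l, h⟩ := exists_reduced hS hG o x
    rcases h.extend_cases hS hx with ⟨-, h', -⟩ | ⟨r, -, h', -⟩
    · exact ⟨l, h'⟩
    · have h1 := h'.dist_eq hS hG hM
      have h2 := h'.2.2.dist_eq hS hG hM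
      simp at h1; omega
  obtain ⟨l, hl⟩ := key hx hdx
  obtain ⟨m, hm⟩ := key hy hdy
  rcases (hl.flipEqv hM hm).last_edges hS with ⟨h, -⟩ | ⟨w, r, hs, h, -⟩
  · exact absurd h hxy
  · have h' := (Reduced.congr hS h).1 hl.2.2
    refine ⟨w, hs, ?_⟩
    rw [h'.dist_eq hS hG hM, h'.2.2.dist_eq hS hG hM, List.length_cons]

end Flip

/-! ### Edges that separate the vertices alike -/

/-- The combinatorial properties of the `1`-skeleton of a CAT(0) cube complex. -/
structure IsCubicalGraph {V : Type*} (G : SimpleGraph V) (Sq : V → V → V → V → Prop) : Prop where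
  squares : SquareAxioms G Sq
  connected : G.Connected
  monodromy : TrivialMonodromy G Sq

namespace IsCubicalGraph

variable {V : Type*} {G : SimpleGraph V} {Sq : V → V → V → V → Prop}

theorem dist_adj (h : IsCubicalGraph G Sq) (o : V) {v u : V} (huv : G.Adj v u) :
    G.dist o u = G.dist o v + 1 ∨ G.dist o v = G.dist o u + 1 :=
  Cubical.dist_adj h.squares h.connected h.monodromy o huv

/-- Opposite edges of a square determine the same half-spaces. -/
theorem closer_of_square (h : IsCubicalGraph G Sq) {x z z' x' : V} (hs : Sq x z z' x') {v : V}
    (hv : G.dist v x < G.dist v z) : G.dist v x' < G.dist v z' := by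
  have hS := h.squares
  have h1 := h.dist_adj v (hS.adj hs)
  have h2 := h.dist_adj v (hS.adj (hS.rot hs))
  have h3 := h.dist_adj v (hS.adj (hS.rot (hS.rot hs)))
  have h4 := h.dist_adj v (hS.adj (hS.rot (hS.rot (hS.rot hs))))
  by_contra hlt
  -- Otherwise `x` and `z'` are equally far from `v`, and `z` and `x'` one further. The quadrangle
  -- condition below `z` gives a square whose fourth vertex must be `x'`, yet is nearer to `v` than
  -- `x`.
  obtain ⟨w, hw, hd⟩ := quadrangle hS h.connected h.monodromy (o := v) (hS.adj hs)
    (hS.adj (hS.rot hs)).symm (hS.ne hs) (by omega) (by omega)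
  obtain rfl : w = x' := hS.unique (hS.rot (hS.rot hw)) (hS.rot hs)
  omega

/-- Distances to adjacent vertices differ by exactly one, and the two inequalities leave only the
distances of a rectangle with one side of length `1`. -/
theorem dist_of_separated (h : IsCubicalGraph G Sq) {x z x' z' : V} (hxz : G.Adj x z)
    (hxz' : G.Adj x' z') (h1 : G.dist x' x < G.dist x' z) (h2 : G.dist z' z < G.dist z' x) :
    G.dist x' z = G.dist x' x + 1 ∧ G.dist z' z = G.dist x' x ∧
      G.dist z' x = G.dist x' x + 1 := by
  have a1 := h.dist_adj x' hxz
  have a2 := h.dist_adj z' hxz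
  have a3 := h.dist_adj x hxz'
  have a4 := h.dist_adj z hxz'
  rw [G.dist_comm (u := x), G.dist_comm (u := x)] at a3
  rw [G.dist_comm (u := z), G.dist_comm (u := z)] at a4
  omega

/-- If the edges `xz` and `x'z'` determine the same half-spaces, then `xz` may be pushed along
geodesics from `x` to `x'`. -/
theorem exists_square (h : IsCubicalGraph G Sq) {x z x' z' x₁ : V} (hxz : G.Adj x z)
    (hxz' : G.Adj x' z') (h1 : G.dist x' x < G.dist x' z) (h2 : G.dist z' z < G.dist z' x)
    (hx₁ : G.Adj x x₁) (hd : G.dist x' x = G.dist x' x₁ + 1) :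
    ∃ z₁, Sq x z z₁ x₁ ∧ G.dist x' x₁ < G.dist x' z₁ ∧ G.dist z' z₁ < G.dist z' x₁ := by
  obtain ⟨d1, d2, d3⟩ := h.dist_of_separated hxz hxz' h1 h2
  have a1 := h.dist_adj z' hx₁
  have a3 := h.dist_adj x₁ hxz'
  rw [G.dist_comm (u := x₁), G.dist_comm (u := x₁)] at a3
  have hne : z ≠ x₁ := by rintro rfl; omega
  -- Seen from `z'`, both `z` and `x₁` are one step nearer than `x`.
  obtain ⟨z₁, hs, hz₁⟩ := quadrangle h.squares h.connected h.monodromy (o := z') hxz.symm hx₁.symm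
    hne (by omega) (by omega)
  have hS := h.squares
  have b1 := h.dist_adj x' (hS.adj hs)
  have b3 := h.dist_adj z₁ hxz'
  rw [G.dist_comm (u := z₁), G.dist_comm (u := z₁)] at b3
  exact ⟨z₁, hS.flip (hS.rot (hS.rot hs)), by omega, by omega⟩

theorem exists_adj_closer (h : IsCubicalGraph G Sq) {x x' : V} (hne : G.dist x' x ≠ 0) :
    ∃ x₁, G.Adj x x₁ ∧ G.dist x' x = G.dist x' x₁ + 1 := by
  obtain ⟨p, hp⟩ := h.connected.exists_walk_length_eq_dist x x'
  rw [G.dist_comm] at hp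
  cases p with
  | nil => exact absurd hp.symm hne
  | @cons _ u _ hu p =>
    refine ⟨u, hu, ?_⟩
    have := SimpleGraph.dist_le p
    rw [G.dist_comm] at this
    have := h.dist_adj x' hu
    simp at hp
    omega

/-- Edges that determine the same half-spaces are dual to the same wall. -/
theorem eq_of_separated (h : IsCubicalGraph G Sq) {α : Type*} (f : V → V → α)
    (hf : ∀ {a b c d}, Sq a b c d → f a b = f d c) {x z x' z' : V} (hxz : G.Adj x z)
    (hxz' : G.Adj x' z') (h1 : G.dist x' x < G.dist x' z) (h2 : G.dist z' z < G.dist z' x) :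
    f x z = f x' z' := by
  induction hn : G.dist x' x generalizing x z with
  | zero =>
    obtain ⟨-, d2, -⟩ := h.dist_of_separated hxz hxz' h1 h2
    rw [h.connected.dist_eq_zero_iff.1 hn, h.connected.dist_eq_zero_iff.1 (d2.trans hn)]
  | succ n ih =>
    obtain ⟨x₁, hx₁, hd⟩ := h.exists_adj_closer (x := x) (x' := x') (by omega)
    obtain ⟨z₁, hs, h1', h2'⟩ := h.exists_square hxz hxz' h1 h2 hx₁ hd
    have hS := h.squares
    rw [hf hs]
    exact ih (hS.adj (hS.rot (hS.rot hs))).symm h1' h2' (by omega)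

end IsCubicalGraph

/-! ### Corners and faces of cubes -/

/-- The vertices of the unit cube. -/
def corner {n : ℕ} (s : Fin n → Bool) : Cube n := fun i => if s i then 1 else 0

theorem corner_injective {n : ℕ} : Function.Injective (corner (n := n)) := by
  intro s s' h
  funext i
  have := congrFun h i
  unfold corner at this
  cases hs : s i <;> cases hs' : s' i <;> simp_all

theorem corner_false {n : ℕ} : corner (fun _ : Fin n => false) = fun _ => 0 := by
  funext i; simp [corner]

theorem IsFaceMap.surjective {m n : ℕ} {φ : Cube m → Cube n} (h : IsFaceMap φ)
    (hφ : ∀ i, ∃ t t', φ t i ≠ φ t' i) : Function.Surjective φ := by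
  obtain ⟨a, r, b, h⟩ := h
  have ha : Function.Surjective a := by
    intro i
    by_contra hi
    obtain ⟨t, t', ht⟩ := hφ i
    exact ht (((h t).2 i hi).trans ((h t').2 i hi).symm)
  intro y
  refine ⟨fun j => if r j then unitInterval.symm (y (a j)) else y (a j), ?_⟩
  funext i
  obtain ⟨j, rfl⟩ := ha i
  rw [(h _).1 j]
  split <;> simp

theorem isFaceMap_corner {n : ℕ} (s : Fin n → Bool) :
    IsFaceMap (fun _ : Cube 0 => corner s) :=
  ⟨⟨Fin.elim0, fun i => i.elim0⟩, Fin.elim0, s, fun _ => ⟨fun i => i.elim0, fun _ _ => rfl⟩⟩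

/-- The edge of the unit cube at the corner `s` in the direction `i`. -/
def line {n : ℕ} (s : Fin n → Bool) (i : Fin n) (t : Cube 1) : Cube n :=
  Function.update (corner s) i (t 0)

theorem isFaceMap_line {n : ℕ} (s : Fin n → Bool) (i : Fin n) : IsFaceMap (line s i) := by
  refine ⟨⟨fun _ => i, fun _ _ _ => Subsingleton.elim _ _⟩, fun _ => false, s, fun t => ⟨?_, ?_⟩⟩
  · intro j
    obtain rfl := Subsingleton.elim j 0
    change line s i t i = t 0
    simp [line]
  · intro l hl
    have : l ≠ i := fun h => hl ⟨0, h.symm⟩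
    simp [line, corner, this]

theorem corner_update_mem_line {n : ℕ} (s : Fin n → Bool) (i : Fin n) (b : Bool) :
    corner (Function.update s i b) ∈ Set.range (line s i) := by
  refine ⟨fun _ => if b then 1 else 0, ?_⟩
  funext l
  by_cases hl : l = i
  · subst hl; simp [line, corner]
  · simp [line, corner, hl]

/-- The square face of the unit cube at the corner `s` in the directions `i` and `l`. -/
def plane {n : ℕ} (s : Fin n → Bool) (i l : Fin n) (t : Cube 2) : Cube n :=
  Function.update (Function.update (corner s) i (if s i then unitInterval.symm (t 0) else t 0)) l
    (if s l then unitInterval.symm (t 1) else t 1)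

theorem isFaceMap_plane {n : ℕ} (s : Fin n → Bool) {i l : Fin n} (h : i ≠ l) :
    IsFaceMap (plane s i l) := by
  refine ⟨⟨![i, l], ?_⟩, ![s i, s l], s, fun t => ⟨?_, ?_⟩⟩
  · intro a b hab
    fin_cases a <;> fin_cases b <;> simp_all
  · intro j
    fin_cases j
    · change plane s i l t i = if s i then unitInterval.symm (t 0) else t 0
      simp [plane, h]
    · change plane s i l t l = if s l then unitInterval.symm (t 1) else t 1
      simp [plane]
  · intro m hm
    have h1 : m ≠ i := fun h => hm ⟨0, h.symm⟩
    have h2 : m ≠ l := fun h => hm ⟨1, h.symm⟩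
    simp [plane, corner, h1, h2]

theorem axis_eq {Y : Type*} {n : ℕ} (σ : Cube n → Y) (i : Fin n) :
    CubeFamily.axis σ i = Set.range (σ ∘ line (fun _ => false) i) := by
  rw [Set.range_comp, CubeFamily.axis]
  congr 1
  ext t
  constructor
  · intro h
    refine ⟨fun _ => t i, ?_⟩
    funext l
    by_cases hl : l = i
    · subst hl; simp [line]
    · simp [line, corner, hl, h l hl]
  · rintro ⟨u, rfl⟩ l hl
    simp [line, corner, hl]

namespace CubeComplex

variable {X : Type*} {C : CubeComplex X}

/-! ### Vertices, edges and squares of a cube complex -/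

theorem isVertex_corner {n : ℕ} {σ : Cube n → X} (hσ : σ ∈ C.charts n) (s : Fin n → Bool) :
    C.IsVertex (σ (corner s)) :=
  ⟨_, C.face 0 n _ (isFaceMap_corner s) σ hσ, ⟨fun i => i.elim0, rfl⟩⟩

/-- The vertex of a parametrised cube at a corner. -/
def vtx {n : ℕ} {σ : Cube n → X} (hσ : σ ∈ C.charts n) (s : Fin n → Bool) : C.Vertex :=
  ⟨σ (corner s), isVertex_corner hσ s⟩

theorem vtx_injective {n : ℕ} {σ : Cube n → X} (hσ : σ ∈ C.charts n) :
    Function.Injective (vtx hσ) := fun _ _ h =>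
  corner_injective (C.injective n σ hσ (congrArg Subtype.val h))

/-- The intersection with a `0`-cube is a face of that `0`-cube, so it has no free direction and is
a corner of `σ`. -/
theorem eq_corner_of_isVertex {n : ℕ} {σ : Cube n → X} (hσ : σ ∈ C.charts n) {t : Cube n}
    (h : C.IsVertex (σ t)) : ∃ s, t = corner s := by
  obtain ⟨τ, hτ, ht⟩ := h
  obtain ⟨k, φ, ψ, ⟨a, r, b, hφ⟩, ⟨a', -, -, -⟩, -, hr⟩ :=
    C.inter n 0 σ hσ τ hτ ⟨_, ⟨t, rfl⟩, ht⟩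
  obtain ⟨u, hu⟩ : σ t ∈ Set.range (σ ∘ φ) := hr ▸ ⟨⟨t, rfl⟩, ht⟩
  refine ⟨b, ?_⟩
  rw [← C.injective n σ hσ hu]
  funext i
  exact (hφ u).2 i fun ⟨j, _⟩ => (a' j).elim0

theorem exists_vtx {n : ℕ} {σ : Cube n → X} (hσ : σ ∈ C.charts n) {x : C.Vertex}
    (h : x.1 ∈ Set.range σ) : ∃ s, x = vtx hσ s := by
  obtain ⟨t, ht⟩ := h
  obtain ⟨s, rfl⟩ := eq_corner_of_isVertex hσ (ht ▸ x.2)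
  exact ⟨s, Subtype.ext ht.symm⟩

/-- The intersection is a face of `σ` on which no coordinate is constant, hence all of `σ`. -/
theorem range_subset {m n : ℕ} {σ : Cube m → X} {τ : Cube n → X} (hσ : σ ∈ C.charts m)
    (hτ : τ ∈ C.charts n) (hne : (Set.range σ ∩ Set.range τ).Nonempty)
    (h : ∀ i, ∃ t t', σ t ∈ Set.range τ ∧ σ t' ∈ Set.range τ ∧ t i ≠ t' i) :
    Set.range σ ⊆ Set.range τ := by
  obtain ⟨k, φ, ψ, hφ, -, -, hr⟩ := C.inter m n σ hσ τ hτ hne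
  have hs : Function.Surjective φ := by
    refine hφ.surjective fun i => ?_
    obtain ⟨t, t', ht, ht', hi⟩ := h i
    obtain ⟨u, hu⟩ : σ t ∈ Set.range (σ ∘ φ) := hr ▸ ⟨⟨t, rfl⟩, ht⟩
    obtain ⟨u', hu'⟩ : σ t' ∈ Set.range (σ ∘ φ) := hr ▸ ⟨⟨t', rfl⟩, ht'⟩
    refine ⟨u, u', ?_⟩
    rwa [C.injective m σ hσ hu, C.injective m σ hσ hu']
  rw [hs.range_comp] at hr
  rw [← hr]
  exact Set.inter_subset_right

theorem edge_subset {e f : C.Edge} {x y : C.Vertex} (hxy : x ≠ y) (hx : x.1 ∈ e.1) (hy : y.1 ∈ e.1)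
    (hx' : x.1 ∈ f.1) (hy' : y.1 ∈ f.1) : e.1 ⊆ f.1 := by
  obtain ⟨_, σ, hσ, rfl⟩ := e
  obtain ⟨_, τ, hτ, rfl⟩ := f
  refine range_subset hσ hτ ⟨_, hx, hx'⟩ fun i => ?_
  obtain ⟨t, ht⟩ := hx
  obtain ⟨u, hu⟩ := hy
  refine ⟨t, u, ht ▸ hx', hu ▸ hy', fun h => hxy (Subtype.ext ?_)⟩
  rw [← ht, ← hu]
  congr 1
  funext j
  rwa [Subsingleton.elim j i]

theorem edge_eq {e f : C.Edge} {x y : C.Vertex} (hxy : x ≠ y) (hx : x.1 ∈ e.1) (hy : y.1 ∈ e.1)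
    (hx' : x.1 ∈ f.1) (hy' : y.1 ∈ f.1) : e = f :=
  Subtype.ext (Set.Subset.antisymm (edge_subset hxy hx hy hx' hy') (edge_subset hxy hx' hy' hx hy))

theorem edge_endpoints {e : C.Edge} {x y z : C.Vertex} (hxy : x ≠ y) (hx : x.1 ∈ e.1)
    (hy : y.1 ∈ e.1) (hz : z.1 ∈ e.1) : z = x ∨ z = y := by
  obtain ⟨_, σ, hσ, rfl⟩ := e
  obtain ⟨s, rfl⟩ := exists_vtx hσ hx
  obtain ⟨s', rfl⟩ := exists_vtx hσ hy
  obtain ⟨s'', rfl⟩ := exists_vtx hσ hz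
  have key : ∀ {s s' : Fin 1 → Bool}, s 0 = s' 0 → s = s' := fun h => by
    funext j; rwa [Subsingleton.elim j 0]
  have hne : s 0 ≠ s' 0 := fun h => hxy (by rw [key h])
  by_cases h : s'' 0 = s 0
  · left; rw [key h]
  · right
    rw [key (s := s'') (s' := s')]
    revert h hne
    cases s'' 0 <;> cases s 0 <;> cases s' 0 <;> simp

/-- The edge of a parametrised cube at the corner `s` in the direction `i`. -/
def edgeAt {n : ℕ} {σ : Cube n → X} (hσ : σ ∈ C.charts n) (s : Fin n → Bool) (i : Fin n) :
    C.Edge :=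
  ⟨Set.range (σ ∘ line s i), _, C.face 1 n _ (isFaceMap_line s i) σ hσ, rfl⟩

theorem vtx_update_mem_edgeAt {n : ℕ} {σ : Cube n → X} (hσ : σ ∈ C.charts n) (s : Fin n → Bool)
    (i : Fin n) (b : Bool) : (vtx hσ (Function.update s i b)).1 ∈ (edgeAt hσ s i).1 := by
  obtain ⟨t, ht⟩ := corner_update_mem_line s i b
  exact ⟨t, congrArg σ ht⟩

theorem vtx_mem_edgeAt {n : ℕ} {σ : Cube n → X} (hσ : σ ∈ C.charts n) (s : Fin n → Bool)
    (i : Fin n) : (vtx hσ s).1 ∈ (edgeAt hσ s i).1 := by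
  simpa using vtx_update_mem_edgeAt hσ s i (s i)

theorem vtx_adj {n : ℕ} {σ : Cube n → X} (hσ : σ ∈ C.charts n) (s : Fin n → Bool) (i : Fin n) :
    C.skeleton.Adj (vtx hσ s) (vtx hσ (Function.update s i (!s i))) := by
  refine ⟨fun h => ?_, edgeAt hσ s i, vtx_mem_edgeAt hσ s i, vtx_update_mem_edgeAt hσ s i _⟩
  simpa using congrFun (vtx_injective hσ h) i

theorem axis_eq_edgeAt {n : ℕ} {σ : Cube n → X} (hσ : σ ∈ C.charts n) (i : Fin n) :
    CubeFamily.axis σ i = (edgeAt hσ (fun _ => false) i).1 := axis_eq σ i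

theorem isSquare_vtx {n : ℕ} {σ : Cube n → X} (hσ : σ ∈ C.charts n) (s : Fin n → Bool)
    {i l : Fin n} (h : i ≠ l) :
    C.IsSquare (vtx hσ s) (vtx hσ (Function.update s i (!s i)))
      (vtx hσ (Function.update (Function.update s i (!s i)) l (!s l)))
      (vtx hσ (Function.update s l (!s l))) := by
  refine ⟨σ ∘ plane s i l, C.face 2 n _ (isFaceMap_plane s h) σ hσ, ?_, ?_, ?_, ?_⟩ <;>
  · refine congrArg σ (funext fun m => ?_)
    by_cases hl : m = l
    · subst hl
      cases hs : s m <;> simp [plane, corner, hs, h.symm]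
    · by_cases hi : m = i
      · subst hi
        cases hs : s m <;> simp [plane, corner, hs, hl]
      · simp [plane, corner, hi, hl]

theorem isSquare_iff {a b c d : C.Vertex} : C.IsSquare a b c d ↔
    ∃ (σ : Cube 2 → X) (hσ : σ ∈ C.charts 2), a = vtx hσ ![false, false] ∧
      b = vtx hσ ![true, false] ∧ c = vtx hσ ![true, true] ∧ d = vtx hσ ![false, true] := by
  have key : ∀ b b' : Bool, corner ![b, b'] = ![if b then 1 else 0, if b' then 1 else 0] := by
    intro b b'
    funext i
    fin_cases i <;> rfl
  constructor
  · rintro ⟨σ, hσ, h1, h2, h3, h4⟩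
    refine ⟨σ, hσ, ?_, ?_, ?_, ?_⟩ <;>
    · refine Subtype.ext ?_
      simp [vtx, *]
  · rintro ⟨σ, hσ, rfl, rfl, rfl, rfl⟩
    exact ⟨σ, hσ, by simp [vtx, key], by simp [vtx, key], by simp [vtx, key], by simp [vtx, key]⟩

theorem isSquare_rot {a b c d : C.Vertex} (h : C.IsSquare a b c d) : C.IsSquare b c d a := by
  obtain ⟨σ, hσ, rfl, rfl, rfl, rfl⟩ := isSquare_iff.1 h
  convert isSquare_vtx hσ ![true, false] (i := 1) (l := 0) (by decide) using 2 <;> decide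

theorem isSquare_flip {a b c d : C.Vertex} (h : C.IsSquare a b c d) : C.IsSquare a d c b := by
  obtain ⟨σ, hσ, rfl, rfl, rfl, rfl⟩ := isSquare_iff.1 h
  convert isSquare_vtx hσ ![false, false] (i := 1) (l := 0) (by decide) using 2 <;> decide

theorem isSquare_adj {a b c d : C.Vertex} (h : C.IsSquare a b c d) : C.skeleton.Adj a b := by
  obtain ⟨σ, hσ, rfl, rfl, rfl, rfl⟩ := isSquare_iff.1 h
  convert vtx_adj hσ ![false, false] 0 using 2; decide

theorem isSquare_ne {a b c d : C.Vertex} (h : C.IsSquare a b c d) : a ≠ c := by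
  obtain ⟨σ, hσ, rfl, rfl, rfl, rfl⟩ := isSquare_iff.1 h
  exact fun h => absurd (vtx_injective hσ h) (by decide)

/-- The three common vertices vary in both directions of the square, so one square contains the
other, and `c` can only be the remaining vertex. -/
theorem isSquare_unique {a b c c' d : C.Vertex} (h : C.IsSquare a b c d)
    (h' : C.IsSquare a b c' d) : c = c' := by
  have hca := isSquare_ne h
  have hcb := (isSquare_adj (isSquare_rot h)).ne
  have hcd := (isSquare_adj (isSquare_rot (isSquare_rot h))).ne
  obtain ⟨σ, hσ, rfl, rfl, rfl, rfl⟩ := isSquare_iff.1 h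
  obtain ⟨τ, hτ, h1, h2, rfl, h4⟩ := isSquare_iff.1 h'
  have m1 : (vtx hσ ![false, false]).1 ∈ Set.range τ := h1 ▸ ⟨_, rfl⟩
  have m2 : (vtx hσ ![true, false]).1 ∈ Set.range τ := h2 ▸ ⟨_, rfl⟩
  have m4 : (vtx hσ ![false, true]).1 ∈ Set.range τ := h4 ▸ ⟨_, rfl⟩
  have hsub : Set.range σ ⊆ Set.range τ := by
    refine range_subset hσ hτ ⟨_, ⟨_, rfl⟩, m1⟩ fun i => ?_
    fin_cases i
    · exact ⟨_, _, m1, m2, by simp [corner]⟩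
    · exact ⟨_, _, m1, m4, by simp [corner]⟩
  obtain ⟨s, hs⟩ := exists_vtx hτ (x := vtx hσ ![true, true]) (hsub ⟨_, rfl⟩)
  have hall : ∀ s : Fin 2 → Bool, s = ![false, false] ∨ s = ![true, false] ∨ s = ![true, true] ∨
      s = ![false, true] := by decide
  rcases hall s with rfl | rfl | rfl | rfl
  · exact absurd (h1.trans hs.symm) hca
  · exact absurd (h2.trans hs.symm) hcb
  · exact hs
  · exact absurd (hs.trans h4.symm) hcd

theorem isCorner_of_isSquare {y a p b : C.Vertex} (h : C.IsSquare y a p b) {e e' : C.Edge}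
    (hy : y.1 ∈ e.1) (ha : a.1 ∈ e.1) (hy' : y.1 ∈ e'.1) (hb : b.1 ∈ e'.1) :
    C.IsCorner y ![e, e'] := by
  have h1 := (isSquare_adj h).ne
  have h2 := (isSquare_adj (isSquare_flip h)).ne
  obtain ⟨σ, hσ, rfl, rfl, rfl, rfl⟩ := isSquare_iff.1 h
  have e0 : (fun _ : Fin 2 => false) = ![false, false] := by decide
  refine ⟨σ, hσ, by rw [← corner_false, e0]; rfl, fun i => ?_⟩
  rw [axis_eq_edgeAt hσ, e0]
  fin_cases i
  · refine congrArg Subtype.val (edge_eq h1 hy ha (vtx_mem_edgeAt hσ _ 0) ?_)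
    rw [show ![true, false] = Function.update ![false, false] 0 true by decide]
    exact vtx_update_mem_edgeAt hσ _ _ _
  · refine congrArg Subtype.val (edge_eq h2 hy' hb (vtx_mem_edgeAt hσ _ 1) ?_)
    rw [show ![false, true] = Function.update ![false, false] 1 true by decide]
    exact vtx_update_mem_edgeAt hσ _ _ _

theorem eq_vtx_of_mem_axis {n : ℕ} {σ : Cube n → X} (hσ : σ ∈ C.charts n) {i : Fin n}
    {a : C.Vertex} (ha : a.1 ∈ CubeFamily.axis σ i) (hne : vtx hσ (fun _ => false) ≠ a) :
    a = vtx hσ (Function.update (fun _ => false) i true) := by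
  rw [axis_eq_edgeAt hσ] at ha
  refine (edge_endpoints ?_ (vtx_mem_edgeAt hσ _ i) (vtx_update_mem_edgeAt hσ _ i true)
    ha).resolve_left hne.symm
  intro h
  simpa using congrFun (vtx_injective hσ h) i

/-- The three edges at `y` pairwise span squares, so flagness gives a `3`-cube. By uniqueness of
squares `p`, `q`, `r` are vertices of it, and `d` is its corner opposite to `y`. -/
theorem isSquare_cube (hC : C.HasFlagLinks) {y a b f p q r : C.Vertex} (h1 : C.IsSquare y a p b)
    (h2 : C.IsSquare y a q f) (h3 : C.IsSquare y b r f) :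
    ∃ d, C.IsSquare a p d q ∧ C.IsSquare b p d r ∧ C.IsSquare f q d r := by
  obtain ⟨hya, ea, ya, aa⟩ := isSquare_adj h1
  obtain ⟨hyb, eb, yb, bb⟩ := isSquare_adj h3
  obtain ⟨hyf, ef, yf, ff⟩ := isSquare_adj (isSquare_flip h3)
  have hab : a ≠ b := isSquare_ne (isSquare_rot h1)
  have haf : a ≠ f := isSquare_ne (isSquare_rot h2)
  have hbf : b ≠ f := isSquare_ne (isSquare_rot h3)
  have nab : ea ≠ eb := by
    rintro rfl; exact (edge_endpoints hya ya aa bb).elim hyb.symm hab.symm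
  have naf : ea ≠ ef := by
    rintro rfl; exact (edge_endpoints hya ya aa ff).elim hyf.symm haf.symm
  have nbf : eb ≠ ef := by
    rintro rfl; exact (edge_endpoints hyb yb bb ff).elim hyf.symm hbf.symm
  obtain ⟨τ, hτ, h0, hax⟩ := hC y 3 ![ea, eb, ef]
    (by
      intro i l h
      fin_cases i <;> fin_cases l <;> simp_all [eq_comm])
    (by intro i; fin_cases i <;> assumption)
    (by
      intro i l hil
      fin_cases i <;> fin_cases l <;> first | exact absurd rfl hil | skip
      · exact isCorner_of_isSquare h1 ya aa yb bb
      · exact isCorner_of_isSquare h2 ya aa yf ff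
      · exact isCorner_of_isSquare (isSquare_flip h1) yb bb ya aa
      · exact isCorner_of_isSquare h3 yb bb yf ff
      · exact isCorner_of_isSquare (isSquare_flip h2) yf ff ya aa
      · exact isCorner_of_isSquare (isSquare_flip h3) yf ff yb bb)
  have e0 : (fun _ : Fin 3 => false) = ![false, false, false] := by decide
  obtain rfl : vtx hτ (fun _ => false) = y := Subtype.ext (by rw [← h0, ← corner_false]; rfl)
  obtain rfl := eq_vtx_of_mem_axis hτ (hax 0 ▸ aa) hya
  obtain rfl := eq_vtx_of_mem_axis hτ (hax 1 ▸ bb) hyb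
  obtain rfl := eq_vtx_of_mem_axis hτ (hax 2 ▸ ff) hyf
  obtain rfl := isSquare_unique h1 (isSquare_vtx hτ (fun _ => false) (i := 0) (l := 1) (by decide))
  obtain rfl := isSquare_unique h2 (isSquare_vtx hτ (fun _ => false) (i := 0) (l := 2) (by decide))
  obtain rfl := isSquare_unique h3 (isSquare_vtx hτ (fun _ => false) (i := 1) (l := 2) (by decide))
  refine ⟨vtx hτ fun _ => true, ?_, ?_, ?_⟩
  · convert isSquare_vtx hτ ![true, false, false] (i := 1) (l := 2) (by decide) using 2 <;> decide
  · convert isSquare_vtx hτ ![false, true, false] (i := 0) (l := 2) (by decide) using 2 <;> decide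
  · convert isSquare_vtx hτ ![false, false, true] (i := 0) (l := 1) (by decide) using 2 <;> decide

theorem squareAxioms (hC : C.HasFlagLinks) : SquareAxioms C.skeleton C.IsSquare where
  adj := isSquare_adj
  rot := isSquare_rot
  flip := isSquare_flip
  ne := isSquare_ne
  unique := isSquare_unique
  cube := isSquare_cube hC

/-! ### Simple connectedness gives trivial monodromy -/

theorem extendWalk_eq_of_edgeHomotopic (hS : SquareAxioms C.skeleton C.IsSquare) {x y : C.Vertex}
    {p q : C.skeleton.Walk x y} (h : C.EdgeHomotopic p q) {o : C.Vertex}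
    {A : FlipClass C.IsSquare} (hA : IsReducedClass C.skeleton o x A) :
    A.extendWalk p = A.extendWalk q := by
  induction h generalizing A with
  | refl => rfl
  | symm _ ih => exact (ih hA).symm
  | trans _ _ ih ih' => exact (ih hA).trans (ih' hA)
  | append _ _ ih ih' =>
    rw [extendWalk_append, extendWalk_append, ih hA, ih' (hA.extendWalk hS _)]
  | backtrack h => exact hA.extend_extend hS h
  | square hs => exact hA.extend_square hS hs

/-- The walk `p q⁻¹ q` is homotopic to `q` because `p q⁻¹` is closed, and to `p` because `q⁻¹ q` is
closed. -/
theorem trivialMonodromy (hS : SquareAxioms C.skeleton C.IsSquare) (hC : C.IsSimplyConnected) :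
    TrivialMonodromy C.skeleton C.IsSquare := by
  intro o v p q
  have h1 : C.EdgeHomotopic ((p.append q.reverse).append q) q :=
    .append (p' := .nil) (hC.2 _ _) (.refl q)
  have h2 : C.EdgeHomotopic (p.append (q.reverse.append q)) (p.append .nil) :=
    .append (.refl p) (hC.2 _ _)
  rw [SimpleGraph.Walk.append_nil, SimpleGraph.Walk.append_assoc] at h2
  exact extendWalk_eq_of_edgeHomotopic hS (h2.symm.trans h1) (isReducedClass_nil o)

theorem IsCAT0.isCubicalGraph (hC : C.IsCAT0) : IsCubicalGraph C.skeleton C.IsSquare where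
  squares := squareAxioms hC.1
  connected := hC.2.1
  monodromy := trivialMonodromy (squareAxioms hC.1) hC.2

end CubeComplex

namespace CubeComplex

variable {X : Type*} {C : CubeComplex X}

/-! ### Walls and half-spaces -/

/-- The vertices `x` and `y` lie on an edge dual to the wall `W`. -/
def Dual (W : C.Wall) (x y : C.Vertex) : Prop :=
  ∃ e : C.Edge, x.1 ∈ e.1 ∧ y.1 ∈ e.1 ∧ C.wall e = W

theorem Dual.wall_eq {W : C.Wall} {x y : C.Vertex} (h : Dual W x y) (hxy : x ≠ y) {e : C.Edge}
    (hx : x.1 ∈ e.1) (hy : y.1 ∈ e.1) : C.wall e = W := by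
  obtain ⟨f, hx', hy', rfl⟩ := h
  rw [edge_eq hxy hx hy hx' hy']

theorem image_eq_edgeAt {σ : Cube 2 → X} (hσ : σ ∈ C.charts 2) (b b' : Bool) :
    σ '' {t | t 1 = if b' then 1 else 0} = (edgeAt hσ ![b, b'] 0).1 := by
  change _ = Set.range (σ ∘ line ![b, b'] 0)
  rw [Set.range_comp]
  congr 1
  ext t
  constructor
  · intro h
    refine ⟨fun _ => t 0, funext fun i => ?_⟩
    fin_cases i
    · simp [line]
    · exact h.symm
  · rintro ⟨u, rfl⟩
    simp [line, corner]

/-- Replaces the fixed coordinates of the parametrised square by its vertices, so that its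
symmetries can be used. -/
theorem opposite_iff {e f : C.Edge} : C.Opposite e f ↔ ∃ a b c d : C.Vertex, C.IsSquare a b c d ∧
    a.1 ∈ e.1 ∧ b.1 ∈ e.1 ∧ d.1 ∈ f.1 ∧ c.1 ∈ f.1 := by
  have key : ∀ {σ : Cube 2 → X} (hσ : σ ∈ C.charts 2) (b b' : Bool),
      (vtx hσ ![b, b']).1 ∈ (edgeAt hσ ![false, b'] 0).1 := by
    intro σ hσ b b'
    have : ![b, b'] = Function.update ![false, b'] 0 b := by
      cases b <;> cases b' <;> decide
    rw [this]
    exact vtx_update_mem_edgeAt hσ _ _ _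
  have hfalse {σ : Cube 2 → X} (hσ : σ ∈ C.charts 2) :
      σ '' {t | t 1 = 0} = (edgeAt hσ ![false, false] 0).1 := image_eq_edgeAt hσ false false
  have htrue {σ : Cube 2 → X} (hσ : σ ∈ C.charts 2) :
      σ '' {t | t 1 = 1} = (edgeAt hσ ![false, true] 0).1 := image_eq_edgeAt hσ false true
  constructor
  · rintro ⟨σ, hσ, he, hf⟩
    refine ⟨_, _, _, _, isSquare_iff.2 ⟨σ, hσ, rfl, rfl, rfl, rfl⟩, ?_⟩
    rw [he, hf, hfalse hσ, htrue hσ]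
    exact ⟨key hσ _ _, key hσ _ _, key hσ _ _, key hσ _ _⟩
  · rintro ⟨a, b, c, d, hs, ha, hb, hd, hc⟩
    have h1 := (isSquare_adj hs).ne
    have h2 := (isSquare_adj (isSquare_rot (isSquare_rot hs))).ne.symm
    obtain ⟨σ, hσ, rfl, rfl, rfl, rfl⟩ := isSquare_iff.1 hs
    refine ⟨σ, hσ, ?_, ?_⟩
    · rw [hfalse hσ, edge_eq h1 ha hb (key hσ _ _) (key hσ _ _)]
    · rw [htrue hσ, edge_eq h2 hd hc (key hσ _ _) (key hσ _ _)]

theorem Dual.of_isSquare {W : C.Wall} {a b c d : C.Vertex} (hs : C.IsSquare a b c d)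
    (h : Dual W a b) : Dual W d c := by
  obtain ⟨e, ha, hb, rfl⟩ := h
  obtain ⟨-, f, hc, hd⟩ := isSquare_adj (isSquare_rot (isSquare_rot hs))
  exact ⟨f, hd, hc, (Quot.sound (opposite_iff.2 ⟨a, b, c, d, hs, ha, hb, hd, hc⟩)).symm⟩

theorem dual_iff_of_isSquare {W : C.Wall} {a b c d : C.Vertex} (hs : C.IsSquare a b c d) :
    Dual W a b ↔ Dual W d c :=
  ⟨.of_isSquare hs, .of_isSquare (isSquare_rot (isSquare_flip hs))⟩

/-! ### Parallel edges of a cube and the vertices of a half-space -/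

/-- The corner of the unit cube with the coordinates `1` in the set `S`. -/
def setCorner {n : ℕ} (S : Finset (Fin n)) : Fin n → Bool := fun i => decide (i ∈ S)

theorem setCorner_empty {n : ℕ} : setCorner (∅ : Finset (Fin n)) = fun _ => false := by
  funext
  simp [setCorner]

theorem setCorner_insert {n : ℕ} {S : Finset (Fin n)} {i : Fin n} (hi : i ∉ S) :
    setCorner (insert i S) = Function.update (setCorner S) i (!setCorner S i) := by
  funext l
  by_cases h : l = i
  · subst h; simp [setCorner, hi]
  · simp [setCorner, h]

/-- Parallel edges of a cube are joined by a chain of squares, one for each element of `S`. -/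
theorem dual_setCorner {n : ℕ} {σ : Cube n → X} (hσ : σ ∈ C.charts n) (W : C.Wall) {i : Fin n}
    (S : Finset (Fin n)) (hi : i ∉ S) :
    Dual W (vtx hσ (setCorner S)) (vtx hσ (setCorner (insert i S))) ↔
      Dual W (vtx hσ (setCorner ∅)) (vtx hσ (setCorner {i})) := by
  induction S using Finset.induction_on with
  | empty => rfl
  | insert l S hl ih =>
    rw [Finset.mem_insert, not_or] at hi
    rw [← ih hi.2]
    have := isSquare_vtx hσ (setCorner S) hi.1
    rw [← setCorner_insert hi.2, ← setCorner_insert hl] at this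
    rw [dual_iff_of_isSquare this, Finset.insert_comm, setCorner_insert (S := insert i S)]
    · simp [setCorner, Ne.symm hi.1]
    · simp [hl, Ne.symm hi.1]

theorem sameSide_setCorner {n : ℕ} {σ : Cube n → X} (hσ : σ ∈ C.charts n) (W : C.Wall)
    (S : Finset (Fin n)) (h : ∀ i ∈ S, C.wall (edgeAt hσ (fun _ => false) i) ≠ W) :
    C.SameSide W (vtx hσ (setCorner ∅)) (vtx hσ (setCorner S)) := by
  induction S using Finset.induction_on with
  | empty => exact .refl
  | insert i S hi ih =>
    refine .tail (ih fun l hl => h l (Finset.mem_insert_of_mem hl)) ?_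
    have hadj := vtx_adj hσ (setCorner S) i
    rw [← setCorner_insert hi] at hadj
    obtain ⟨-, e, h1, h2⟩ := hadj
    refine ⟨e, h1, h2, fun hW => h i (Finset.mem_insert_self i S) ?_⟩
    have hd := (dual_setCorner hσ W S hi).1 ⟨e, h1, h2, hW⟩
    have e1 : setCorner {i} = Function.update (fun _ => false) i true := by
      rw [← insert_empty_eq, setCorner_insert (by simp), setCorner_empty]; rfl
    rw [setCorner_empty, e1] at hd
    refine hd.wall_eq (fun h => ?_) (vtx_mem_edgeAt hσ _ i) (vtx_update_mem_edgeAt hσ _ i true)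
    simpa using congrFun (vtx_injective hσ h) i

/-- The coordinates of a vertex are `0` or `1`, so the bound `1 / 2` forces `0` in every direction
dual to `W`. The vertex is then reached from the corner `0` without crossing `W`. -/
theorem mem_halfSpace {W : C.Wall} {x p : C.Vertex} :
    p.1 ∈ C.halfSpace W x ↔ C.SameSide W x p := by
  constructor
  · rintro ⟨n, σ, t, hσ, hp, ⟨y, hy, hxy⟩, ht⟩
    obtain ⟨s, rfl⟩ := eq_corner_of_isVertex hσ (hp ▸ p.2)
    have hs : s = setCorner (Finset.univ.filter fun i => s i = true) := by
      funext i; simp [setCorner]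
    obtain rfl : p = vtx hσ s := Subtype.ext hp
    obtain rfl : y = vtx hσ (setCorner ∅) := Subtype.ext (by
      rw [hy, ← corner_false, ← setCorner_empty]; rfl)
    refine hxy.trans ?_
    rw [hs]
    refine sameSide_setCorner hσ W _ fun i hi hW => ?_
    have := ht i ⟨_, hW, (axis_eq_edgeAt hσ i).symm⟩
    have hsi : s i = true := by simpa using hi
    norm_num [corner, hsi] at this
  · intro h
    obtain ⟨σ, hσ, t, ht⟩ := p.2
    refine ⟨0, σ, t, hσ, ht.symm, ⟨p, ?_, h⟩, fun i => i.elim0⟩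
    rw [← ht]
    congr 1
    exact Subsingleton.elim _ _

theorem SameSide.symm {W : C.Wall} {x y : C.Vertex} (h : C.SameSide W x y) : C.SameSide W y x := by
  induction h with
  | refl => exact .refl
  | tail _ h ih =>
    obtain ⟨e, h1, h2, h3⟩ := h
    exact .head ⟨e, h2, h1, h3⟩ ih

/-! ### Half-spaces in terms of distances; convexity -/

/-- The vertices closer to `x` than to `z`. -/
def closer (C : CubeComplex X) (x z : C.Vertex) : Set C.Vertex :=
  {v | C.skeleton.dist v x < C.skeleton.dist v z}

theorem not_mem_closer (hC : C.IsCAT0) {x z v : C.Vertex} (h : C.skeleton.Adj x z) :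
    v ∉ C.closer x z ↔ v ∈ C.closer z x := by
  have := hC.isCubicalGraph.dist_adj v h
  simp only [closer, Set.mem_ofPred_eq]
  omega

theorem self_mem_closer (hC : C.IsCAT0) {x z : C.Vertex} (h : x ≠ z) : x ∈ C.closer x z := by
  rw [closer, Set.mem_ofPred_eq, SimpleGraph.dist_self]
  exact hC.2.1.pos_dist_of_ne h

theorem closer_eq_of_isSquare (hC : C.IsCAT0) {a b c d : C.Vertex} (hs : C.IsSquare a b c d) :
    C.closer a b = C.closer d c :=
  Set.Subset.antisymm (fun _ => hC.isCubicalGraph.closer_of_square hs)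
    (fun _ => hC.isCubicalGraph.closer_of_square (isSquare_rot (isSquare_flip hs)))

/-- The two sides of an edge, in terms of distances. -/
def sides (C : CubeComplex X) (e : C.Edge) : Set (Set C.Vertex) :=
  {S | ∃ x z : C.Vertex, x ≠ z ∧ x.1 ∈ e.1 ∧ z.1 ∈ e.1 ∧ S = C.closer x z}

theorem sides_subset (hC : C.IsCAT0) {e f : C.Edge} (h : C.Opposite e f) :
    C.sides e ⊆ C.sides f := by
  obtain ⟨a, b, c, d, hs, ha, hb, hd, hc⟩ := opposite_iff.1 h
  have hab := (isSquare_adj hs).ne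
  have hcd := (isSquare_adj (isSquare_rot (isSquare_rot hs))).ne
  rintro S ⟨x, z, hxz, hx, hz, rfl⟩
  rcases edge_endpoints hab ha hb hx with rfl | rfl <;>
    rcases edge_endpoints hab ha hb hz with rfl | rfl
  · exact absurd rfl hxz
  · exact ⟨d, c, hcd.symm, hd, hc, closer_eq_of_isSquare hC hs⟩
  · exact ⟨c, d, hcd, hc, hd, closer_eq_of_isSquare hC (isSquare_flip (isSquare_rot hs))⟩
  · exact absurd rfl hxz

theorem sides_eq (hC : C.IsCAT0) {e f : C.Edge} (h : C.wall e = C.wall f) :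
    C.sides e = C.sides f := by
  have key : ∀ e f : C.Edge, C.Opposite e f → C.sides e = C.sides f := by
    intro e f h
    refine Set.Subset.antisymm (sides_subset hC h) (sides_subset hC ?_)
    obtain ⟨a, b, c, d, hs, ha, hb, hd, hc⟩ := opposite_iff.1 h
    exact opposite_iff.2 ⟨d, c, b, a, isSquare_rot (isSquare_flip hs), hd, hc, ha, hb⟩
  exact congrArg (Quot.lift C.sides key) h

/-- An edge leaving `C.closer x z` separates the vertices as `xz` does, so by `eq_of_separated` it
is dual to `W`. A path that avoids `W` has no such edge. -/
theorem mem_closer_of_sameSide (hC : C.IsCAT0) {W : C.Wall} {x z u v : C.Vertex}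
    (hxz : C.skeleton.Adj x z) (hW : Dual W x z) (h : C.SameSide W u v) (hu : u ∈ C.closer x z) :
    v ∈ C.closer x z := by
  induction h with
  | refl => exact hu
  | @tail v w _ h ih =>
    obtain ⟨e, hv, hw, he⟩ := h
    by_contra hcl
    have hne : v ≠ w := by rintro rfl; exact hcl ih
    have hd := hC.isCubicalGraph.eq_of_separated (Dual W)
      (fun hs => propext (dual_iff_of_isSquare hs)) hxz ⟨hne, e, hv, hw⟩ ih
      ((not_mem_closer hC hxz).1 hcl)
    exact he ((hd ▸ hW : Dual W v w).wall_eq hne hv hw)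

/-- Edges `xz` and `x'z'` dual to the same wall, with `x` and `x'` on the same side of it. -/
theorem separated_of_sameSide (hC : C.IsCAT0) {e e' : C.Edge} (hee : C.wall e = C.wall e')
    {x z x' z' : C.Vertex} (hxz : x ≠ z) (hx : x.1 ∈ e.1) (hz : z.1 ∈ e.1) (hxz' : x' ≠ z')
    (hx' : x'.1 ∈ e'.1) (hz' : z'.1 ∈ e'.1) (h : C.SameSide (C.wall e) x x') :
    x' ∈ C.closer x z ∧ z' ∈ C.closer z x := by
  have h1 := mem_closer_of_sameSide hC ⟨hxz, e, hx, hz⟩ ⟨e, hx, hz, rfl⟩ h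
    (self_mem_closer hC hxz)
  refine ⟨h1, ?_⟩
  have hS : C.closer x z ∈ C.sides e' := sides_eq hC hee ▸ ⟨x, z, hxz, hx, hz, rfl⟩
  obtain ⟨x'', z'', hne, hx'', hz'', hcl⟩ := hS
  -- This fixes the orientation of `e'`: if `x''` were `z'`, then `x'` would be closer to `z'` than
  -- to itself.
  have hx0 : x'' = x' := by
    refine (edge_endpoints hxz' hx' hz' hx'').resolve_right ?_
    rintro rfl
    rcases edge_endpoints hxz' hx' hz' hz'' with rfl | rfl
    · rw [hcl] at h1
      simp [closer] at h1
    · exact hne rfl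
  subst hx0
  obtain rfl : z'' = z' := (edge_endpoints hxz' hx' hz' hz'').resolve_left hne.symm
  rw [← not_mem_closer hC ⟨hxz, e, hx, hz⟩, hcl]
  simp [closer]

/-- If `x` and `x'` lie in an intersection `Z` of half-spaces and the edge `e` leads out of `Z` at
`x`, then `x` and `x'` lie on the same side of the wall dual to `e`. -/
theorem sameSide_of_crossesOut {𝓕 : Set (Set X)} (h𝓕 : ∀ A ∈ 𝓕, C.IsHalfSpace A) {e : C.Edge}
    {x z x' : C.Vertex} (hx : x.1 ∈ e.1) (hz : z.1 ∈ e.1) (hxZ : x.1 ∈ ⋂₀ 𝓕) (hzZ : z.1 ∉ ⋂₀ 𝓕)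
    (hxZ' : x'.1 ∈ ⋂₀ 𝓕) : C.SameSide (C.wall e) x x' := by
  simp only [Set.mem_sInter, not_forall] at hzZ
  obtain ⟨A, hA, hzA⟩ := hzZ
  have h1 := hxZ A hA
  have h2 := hxZ' A hA
  obtain ⟨W, o, rfl⟩ := h𝓕 A hA
  rw [mem_halfSpace] at h1 h2 hzA
  -- The half-space contains `x` but not `z`, so the edge `e` has to cross its wall.
  have : C.wall e = W := by
    by_contra h
    exact hzA (h1.tail ⟨e, hx, hz, h⟩)
  rw [this]
  exact (SameSide.symm h1).trans h2

/-- Intersections of half-spaces are convex. -/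
theorem mem_sInter_of_closer (hC : C.IsCAT0) {𝓕 : Set (Set X)} (h𝓕 : ∀ A ∈ 𝓕, C.IsHalfSpace A)
    {x x' x₁ : C.Vertex} (hxZ : x.1 ∈ ⋂₀ 𝓕) (hxZ' : x'.1 ∈ ⋂₀ 𝓕) (hadj : C.skeleton.Adj x x₁)
    (hd : x' ∈ C.closer x₁ x) : x₁.1 ∈ ⋂₀ 𝓕 := by
  intro A hA
  have h1 := hxZ A hA
  have h2 := hxZ' A hA
  obtain ⟨W, o, rfl⟩ := h𝓕 A hA
  rw [mem_halfSpace] at h1 h2 ⊢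
  obtain ⟨hne, f, hf, hf₁⟩ := id hadj
  by_cases hW : C.wall f = W
  · have := mem_closer_of_sameSide hC hadj ⟨f, hf, hf₁, hW⟩ ((SameSide.symm h1).trans h2)
      (self_mem_closer hC hne)
    exact absurd this ((not_mem_closer hC hadj).2 hd)
  · exact h1.tail ⟨f, hf, hf₁, hW⟩

/-! ### Colourings -/

variable {G : Type*} [Group G] [MulAction G X] {K : Subgroup G} {R : ℝ} {k j : ℕ}

theorem Colouring.agree_of_cls_eq {c c' : C.Colouring K R k} {W : C.Wall} (h : c.cls W = c'.cls W)
    {V : (C.quotient K).Wall}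
    (hV : (C.wallGraph K R).edist (C.bar K W) V ≤ (c.colour W : ℕ∞)) : c' V = c V := by
  have : c' ∈ c.cls W := h ▸ fun _ _ => rfl
  exact this V hV

theorem Colouring.colour_eq_of_cls_eq {c c' : C.Colouring K R k} {W : C.Wall}
    (h : c.cls W = c'.cls W) : c.colour W = c'.colour W := by
  rw [colour, colour, agree_of_cls_eq h (by simp)]

/-- The centre belongs to the ball, so the two colourings also give the same radius. -/
theorem Colouring.cls_eq_of_agree {c c' : C.Colouring K R k} {W : C.Wall}
    (h : ∀ V, (C.wallGraph K R).edist (C.bar K W) V ≤ (c.colour W : ℕ∞) → c' V = c V) :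
    c.cls W = c'.cls W := by
  have hcol : c'.colour W = c.colour W := by
    rw [colour, colour, h _ (by simp)]
  ext d
  simp only [cls, Set.mem_ofPred_eq, hcol]
  exact forall_congr' fun V => forall_congr' fun hV => by rw [h V hV]

theorem mem_carrier_bar {σ : Cube 2 → X} (hσ : σ ∈ C.charts 2) {e : C.Edge} {i : Fin 2}
    (he : e.1 = CubeFamily.axis σ i) {t : Cube 2} (ht : (t i : ℝ) = 1 / 2) :
    (Quotient.mk _ (σ t) : MulAction.orbitRel.Quotient K X) ∈ (C.bar K (C.wall e)).carrier := by
  refine ⟨2, _, i, t, ⟨σ, hσ, rfl⟩, ⟨_, rfl, ?_⟩, ht, rfl⟩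
  simp only [CubeFamily.mapEdge, he, CubeFamily.axis, Set.image_comp]

/-- The walls dual to adjacent edges of a square are at distance `0` in the quotient. -/
theorem setEDist_of_isCorner {x : C.Vertex} {e f : C.Edge} (h : C.IsCorner x ![e, f]) :
    (C.quotient K).setEDist (C.bar K (C.wall e)).carrier (C.bar K (C.wall f)).carrier = 0 := by
  obtain ⟨σ, hσ, -, hax⟩ := h
  -- The centre of the square lies on both midcubes.
  let t : Cube 2 := fun _ => ⟨1 / 2, by norm_num, by norm_num⟩
  refine le_antisymm (le_trans (iInf₂_le _ (mem_carrier_bar hσ (hax 0) (t := t) rfl)) ?_) bot_le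
  refine le_trans (iInf₂_le _ (mem_carrier_bar hσ (hax 1) (t := t) rfl)) ?_
  exact le_trans (iInf₂_le 0 (.nil _)) (by simp)

/-! ### Transport of colour classes along a boundary wall -/

namespace Triple

variable {hG : C.ActsCubically G} (T : Triple hG K R k j)

/-- The class of the boundary wall does not change along an edge `xx₁` of `Z` that spans a square
with an edge `xz` crossing out of `Z`. -/
theorem cls_eq_of_isSquare {x z z₁ x₁ : C.Vertex} (hs : C.IsSquare x z z₁ x₁) (hx : x.1 ∈ T.Z)
    (hz : z.1 ∉ T.Z) (hx₁ : x₁.1 ∈ T.Z) {W : C.Wall} (hW : Dual W x z) :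
    (T.c x hx).cls W = (T.c x₁ hx₁).cls W ∧ z₁.1 ∉ T.Z := by
  obtain ⟨e, hxe, hze, rfl⟩ := hW
  obtain ⟨hne, f, hxf, hx₁f⟩ := isSquare_adj (isSquare_flip hs)
  have hj : (T.c x hx).colour (C.wall e) ≤ j :=
    not_lt.1 fun h => hz ((T.boundary e x z hx (isSquare_adj hs).ne hxe hze).2 h)
  have hj' : j < (T.c x hx).colour (C.wall f) := (T.boundary f x x₁ hx hne hxf hx₁f).1 hx₁
  -- The threshold `j` separates the two colours, so the crossing walls remain distinct in the
  -- quotient.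
  have hbar : C.bar K (C.wall f) ≠ C.bar K (C.wall e) := by
    intro h
    have : (T.c x hx).colour (C.wall f) = (T.c x hx).colour (C.wall e) := by
      rw [Colouring.colour, Colouring.colour, h]
    omega
  have hadj : (C.wallGraph K R).Adj (C.bar K (C.wall f)) (C.bar K (C.wall e)) := by
    refine (SimpleGraph.fromRel_adj _ _ _).2 ⟨hbar, Or.inl ?_⟩
    rw [setEDist_of_isCorner (isCorner_of_isSquare (isSquare_flip hs) hxf hx₁f hxe hze)]
    exact bot_le
  have hcls : (T.c x hx).cls (C.wall e) = (T.c x₁ hx₁).cls (C.wall e) := by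
    refine Colouring.cls_eq_of_agree fun V hV =>
      Colouring.agree_of_cls_eq (T.adjacent f x x₁ hx hx₁ hne hxf hx₁f) ?_
    -- The centres are one step apart in `Γ`, and the strict inequality between the two colours
    -- absorbs this step.
    calc (C.wallGraph K R).edist (C.bar K (C.wall f)) V
        ≤ (C.wallGraph K R).edist (C.bar K (C.wall f)) (C.bar K (C.wall e)) +
          (C.wallGraph K R).edist (C.bar K (C.wall e)) V := SimpleGraph.edist_triangle
      _ ≤ 1 + ((T.c x hx).colour (C.wall e) : ℕ∞) := by
          gcongr
          exact (SimpleGraph.edist_eq_one_iff_adj.2 hadj).le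
      _ ≤ ((T.c x hx).colour (C.wall f) : ℕ∞) := by
          exact_mod_cast (by omega :
            1 + (T.c x hx).colour (C.wall e) ≤ (T.c x hx).colour (C.wall f))
  refine ⟨hcls, fun hz₁ => ?_⟩
  obtain ⟨hne₁, e₁, hz₁e, hx₁e⟩ := isSquare_adj (isSquare_rot (isSquare_rot hs))
  have hw : C.wall e₁ = C.wall e :=
    (Dual.of_isSquare hs ⟨e, hxe, hze, rfl⟩).wall_eq hne₁.symm hx₁e hz₁e
  -- If `z₁` lay in `Z`, the colour of the wall under `c_{x₁}` would exceed `j`; but it equals the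
  -- colour under `c_x`.
  have := (T.boundary e₁ x₁ z₁ hx₁ hne₁.symm hx₁e hz₁e).1 hz₁
  rw [hw, ← Colouring.colour_eq_of_cls_eq hcls] at this
  omega

/-- The class of a boundary wall is the same at all edges crossing out of `Z` through it. -/
theorem cls_eq_of_separated (hC : C.IsCAT0) {x z x' z' : C.Vertex} (hadj : C.skeleton.Adj x z)
    (hadj' : C.skeleton.Adj x' z') (hx : x.1 ∈ T.Z) (hz : z.1 ∉ T.Z) (hx' : x'.1 ∈ T.Z)
    {W : C.Wall} (hW : Dual W x z) (h1 : x' ∈ C.closer x z) (h2 : z' ∈ C.closer z x) :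
    (T.c x hx).cls W = (T.c x' hx').cls W := by
  induction hn : C.skeleton.dist x' x generalizing x z with
  | zero =>
    obtain rfl := hC.2.1.dist_eq_zero_iff.1 hn
    rfl
  | succ n ih =>
    have hgr := hC.isCubicalGraph
    obtain ⟨x₁, hx₁, hd⟩ := hgr.exists_adj_closer (x := x) (x' := x') (by omega)
    obtain ⟨z₁, hs, h1', h2'⟩ := hgr.exists_square hadj hadj' h1 h2 hx₁ hd
    obtain ⟨𝓕, h𝓕, hZ⟩ := T.inter_halfSpaces
    have hx₁Z : x₁.1 ∈ T.Z := by
      rw [hZ] at hx hx' ⊢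
      exact mem_sInter_of_closer hC h𝓕 hx hx' hx₁ (by simp only [closer, Set.mem_ofPred_eq]; omega)
    obtain ⟨hcls, hz₁⟩ := T.cls_eq_of_isSquare hs hx hz hx₁Z hW
    rw [hcls]
    exact ih (isSquare_adj (isSquare_rot (isSquare_rot hs))).symm hx₁Z hz₁ (hW.of_isSquare hs)
      h1' h2' (by omega)

end Triple

end CubeComplex

end Cubical

/-! ### The Zipping Lemma -/

theorem lemma8p3 {X : Type*} {G : Type*} [Group G] [MulAction G X]
    (C : Cubical.CubeComplex X) (hC : C.IsCAT0) (hG : C.ActsCubically G)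
    (K : Subgroup G) (hKnormal : K.Normal) (hKfree : ∀ g ∈ K, ∀ p : X, g • p = p → g = 1)
    (R : ℝ) (hR : 1 < R) (k j : ℕ)
    (T : Cubical.CubeComplex.Triple hG K R k j)
    (cE : C.Edge → C.Colouring K R k) (hcE : T.IsEdgeColouring cE)
    (W : C.Wall) (hW : C.IsBoundaryWall T.Z W) :
    ∀ e e' : C.Edge, C.CrossesOut T.Z e → C.wall e = W →
      C.CrossesOut T.Z e' → C.wall e' = W →
        (cE e).cls W = (cE e').cls W ∧ (cE e).colour W = (cE e').colour W := by
  rintro e e' ⟨x, z, hxe, hze, hx, hz⟩ hWe ⟨x', z', hxe', hze', hx', hz'⟩ hWe'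
  have hne : x ≠ z := by rintro rfl; exact hz hx
  have hne' : x' ≠ z' := by rintro rfl; exact hz' hx'
  have hside : C.SameSide (C.wall e) x x' := by
    obtain ⟨𝓕, h𝓕, hZ⟩ := T.inter_halfSpaces
    rw [hZ] at hx hz hx'
    exact Cubical.CubeComplex.sameSide_of_crossesOut h𝓕 hxe hze hx hz hx'
  obtain ⟨h1, h2⟩ := Cubical.CubeComplex.separated_of_sameSide hC (hWe.trans hWe'.symm) hne hxe hze
    hne' hxe' hze' hside
  have hcls := T.cls_eq_of_separated hC ⟨hne, e, hxe, hze⟩ ⟨hne', e', hxe', hze'⟩ hx hz hx'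
    ⟨e, hxe, hze, hWe⟩ h1 h2
  have hE := hcE e x hx hxe
  have hE' := hcE e' x' hx' hxe'
  rw [hWe] at hE
  rw [hWe'] at hE'
  have hfinal := hE.trans (hcls.trans hE'.symm)
  exact ⟨hfinal, Cubical.CubeComplex.Colouring.colour_eq_of_cls_eq hfinal⟩
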